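/- All Hilbert spaces are real. Let $(H_0,H_1)$ be a Hilbert space pair: $H_0$ and $H_1$ are infinite dimensional Hilbert spaces, $H_1\subset H_0$ is dense, and the inclusion $\iota\colon H_1\to H_0$ is a compact bounded linear map. Call $A\in\mathcal L(H_1,H_0)$ symmetrizable if there is an inner product $\langle\cdot,\cdot\rangle'$ on $H_0$, equivalent to the given one, with $\langle Ax,y\rangle'=\langle x,Ay\rangle'$ for all $x,y\in H_1$. Let $\mathcal F$ be the set of symmetrizable Fredholm operators $H_1\to H_0$ of index zero, with the operator norm topology, and let $\mathcal A^*_{I_+}$ be the set of continuous maps $A\colon[0,\infty)\to\mathcal F$ such that $\lim_{s\to\infty}A(s)$ exists in $\mathcal F$ and both this limit and $A(0)$ are invertible. For an interval $I$ put $P_0(I)=L^2(I,H_0)$, and put $P_1(\mathbb R_+)=L^2(\mathbb R_+,H_1)\cap W^{1,2}(\mathbb R_+,H_0)$ with norm $\|\xi\|_{P_1(\mathbb R_+)}^2=\int_0^\infty\|\partial_s\xi(s)\|_0^2\,ds+\int_0^\infty\|\xi(s)\|_1^2\,ds$, where $\mathbb R_+=[0,\infty)$. For $A\in\mathcal A^*_{I_+}$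 let $D_A\colon P_1(\mathbb R_+)\to P_0(\mathbb R_+)$, $D_A\xi=\partial_s\xi+A\xi$. Let $T_{\mathrm g}\in\mathcal L(H_1)$ be the growth operator, $\langle x,y\rangle_0=\langle x,T_{\mathrm g}y\rangle_1$ for $x,y\in H_1$. The interpolation space $H_{1/2}\subset H_0$ consists of all $x\in H_0$ with $\|x\|_{1/2}^2:=\sum_\kappa\kappa^{-1/2}\|x_\kappa\|_0^2<\infty$, where $\kappa$ runs over the eigenvalues of $T_{\mathrm g}$ and $x_\kappa$ is the $H_0$-orthogonal projection of $x$ to $\ker(T_{\mathrm g}-\kappa)$. For $\mathbb A\in\mathcal F$ invertible let $H^\pm_{1/2}(\mathbb A)$ be the closures in $H_{1/2}$ of the span of the eigenvectors of $\mathbb A$ for positive, respectively negative, eigenvalues, and let $\pi_+^{\mathbb A}$ be the projection of $H_{1/2}$ onto $H^+_{1/2}(\mathbb A)$ along $H^-_{1/2}(\mathbb A)$. **Theorem.** Let $A\in\mathcal A^*_{I_+}$. Then $H_{1/2}=H^+_{1/2}(A(0))\oplus H^-_{1/2}(A(0))$, and there are constants $T,c>0$ such that every $\xi\in P_1(\mathbb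 R_+)$ has a representative continuous as a map $[0,\infty)\to H_0$, whose value $\xi(0)$ lies in $H_{1/2}$, and $$ \|\xi\|_{P_1(\mathbb R_+)}\le c\left(\|\xi\|_{P_0([0,T])}+\|D_A\xi\|_{P_0(\mathbb R_+)}+\|\pi_+^{A(0)}\xi(0)\|_{1/2}\right). $$ -/

import Mathlib

open MeasureTheory Set Filter Topology
open scoped ENNReal ContDiff

noncomputable section

namespace HessianPath

variable {H₀ H₁ : Type*}
  [NormedAddCommGroup H₀] [InnerProductSpace ℝ H₀] [CompleteSpace H₀]
  [NormedAddCommGroup H₁] [InnerProductSpace ℝ H₁] [CompleteSpace H₁]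

/-! ### Hilbert space pairs and Hessians -/

/-- A Hilbert space pair `(H₀, H₁)`: both spaces are infinite dimensional Hilbert spaces and
`H₁ ⊂ H₀`, realised by the injective bounded map `ι`, is dense with compact inclusion map. -/
class HilbertPair (ι : H₁ →L[ℝ] H₀) : Prop where
  infinite_dim_zero : ¬ FiniteDimensional ℝ H₀
  infinite_dim_one : ¬ FiniteDimensional ℝ H₁
  injective : Function.Injective ι
  denseRange : DenseRange ι
  compact : IsCompactOperator ι

/-- The inner product `p` is equivalent to the given inner product of `H₀`: the induced norms are
equivalent. -/
def IsEquivalentInner (p : InnerProductSpace.Core ℝ H₀) : Prop :=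
  ∃ c : ℝ, 0 < c ∧ ∀ x : H₀, 1 / c * ‖x‖ ≤ √(p.inner x x) ∧ √(p.inner x x) ≤ c * ‖x‖

/-- `A : H₁ → H₀` is symmetrizable: it is symmetric for some inner product on `H₀` that is
equivalent to the given one. -/
def IsSymmetrizable (ι A : H₁ →L[ℝ] H₀) : Prop :=
  ∃ p : InnerProductSpace.Core ℝ H₀, IsEquivalentInner p ∧
    ∀ x y : H₁, p.inner (A x) (ι y) = p.inner (ι x) (A y)

/-- The set `𝓕` of Hessians: symmetrizable Fredholm operators of index zero. -/
structure IsHessian (ι A : H₁ →L[ℝ] H₀) : Prop where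
  symmetrizable : IsSymmetrizable ι A
  fredholm : A.IsFredholm
  index_zero : Module.finrank ℝ A.ker = Module.finrank ℝ (H₀ ⧸ A.range)

/-- The space `𝓐*` of Hessian paths on `[0, ∞)`: continuous paths `A : [0, ∞) → 𝓕` such that the
limit of `A s` as `s → ∞` exists in `𝓕` and both this limit and `A 0` are invertible. The values
of `A` at negative times are irrelevant. -/
structure IsHessianPath (ι : H₁ →L[ℝ] H₀) (A : ℝ → H₁ →L[ℝ] H₀) : Prop where
  isHessian : ∀ s, 0 ≤ s → IsHessian ι (A s)
  continuousOn : ContinuousOn A (Ici 0)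
  invertible_zero : (A 0).IsInvertible
  exists_limit : ∃ Ap : H₁ →L[ℝ] H₀, Tendsto A atTop (𝓝 Ap) ∧ IsHessian ι Ap ∧ Ap.IsInvertible

/-! ### Path spaces -/

/-- Lebesgue measure on the half line `[0, ∞)`. -/
abbrev halfLine : Measure ℝ := volume.restrict (Ici 0)

/-- `P₀(ℝ₊) = L²(ℝ₊, H₀)`. -/
abbrev P0 (H₀ : Type*) [NormedAddCommGroup H₀] : Type _ := Lp H₀ 2 halfLine

/-- `v` is the weak derivative on the half line of the `H₀`-valued function `ι ∘ u`. -/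
def IsWeakDeriv (ι : H₁ →L[ℝ] H₀) (u : Lp H₁ 2 halfLine) (v : Lp H₀ 2 halfLine) : Prop :=
  ∀ φ : ℝ → ℝ, ContDiff ℝ ∞ φ → HasCompactSupport φ → tsupport φ ⊆ Ioi 0 →
    ∫ s in Ici (0 : ℝ), deriv φ s • ι (u s) = - ∫ s in Ici (0 : ℝ), φ s • v s

/-- A test function or its derivative times an `L²` function is integrable. -/
theorem integrable_smul_of_compactSupport {E : Type*} [NormedAddCommGroup E] [NormedSpace ℝ E]
    {g : ℝ → ℝ} (hg : Continuous g) (hc : HasCompactSupport g) {f : ℝ → E}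
    (hf : MemLp f 2 halfLine) : Integrable (fun s => g s • f s) halfLine := by
  have h : MemLp g 2 halfLine := hg.memLp_of_hasCompactSupport hc
  exact memLp_one_iff_integrable.mp (hf.smul h)

/-- `P₁(ℝ₊) = L²(ℝ₊, H₁) ∩ W^{1,2}(ℝ₊, H₀)`. An element is a class `ξ ∈ L²(ℝ₊, H₁)` together with
its (unique) weak derivative in `L²(ℝ₊, H₀)`; the norm is
`‖ξ‖² = ∫ ‖ξ' s‖₀² ds + ∫ ‖ξ s‖₁² ds`. -/
def P1 (ι : H₁ →L[ℝ] H₀) :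
    Submodule ℝ (WithLp 2 (Lp H₁ 2 halfLine × Lp H₀ 2 halfLine)) where
  carrier := {x | IsWeakDeriv ι x.fst x.snd}
  zero_mem' := by
    intro φ _ _ _
    have h1 : ∫ s in Ici (0 : ℝ), deriv φ s • ι ((0 : Lp H₁ 2 halfLine) s) = 0 := by
      rw [← integral_zero ℝ H₀ (μ := halfLine)]
      apply integral_congr_ae
      filter_upwards [Lp.coeFn_zero H₁ 2 halfLine] with s hs
      rw [hs, Pi.zero_apply, map_zero, smul_zero]
    have h2 : ∫ s in Ici (0 : ℝ), φ s • ((0 : Lp H₀ 2 halfLine) s) = 0 := by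
      rw [← integral_zero ℝ H₀ (μ := halfLine)]
      apply integral_congr_ae
      filter_upwards [Lp.coeFn_zero H₀ 2 halfLine] with s hs
      rw [hs, Pi.zero_apply, smul_zero]
    exact h1.trans (by rw [← neg_zero]; exact congrArg Neg.neg h2.symm)
  add_mem' := by
    intro x y hx hy φ h1 h2 h3
    have hx := hx φ h1 h2 h3
    have hy := hy φ h1 h2 h3
    have hd : Continuous (deriv φ) := h1.continuous_deriv (by simp)
    have e1 : ∫ s in Ici (0 : ℝ), deriv φ s • ι ((x + y).fst s)
        = ∫ s in Ici (0 : ℝ), (deriv φ s • ι (x.fst s) + deriv φ s • ι (y.fst s)) := by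
      apply integral_congr_ae
      filter_upwards [Lp.coeFn_add x.fst y.fst] with s hs
      simp only [WithLp.add_fst, hs, Pi.add_apply, map_add, smul_add]
    have e2 : ∫ s in Ici (0 : ℝ), φ s • ((x + y).snd s)
        = ∫ s in Ici (0 : ℝ), (φ s • x.snd s + φ s • y.snd s) := by
      apply integral_congr_ae
      filter_upwards [Lp.coeFn_add x.snd y.snd] with s hs
      simp only [WithLp.add_snd, hs, Pi.add_apply, smul_add]
    rw [e1, e2, integral_add, integral_add, hx, hy, neg_add]
    · exact integrable_smul_of_compactSupport h1.continuous h2 (Lp.memLp _)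
    · exact integrable_smul_of_compactSupport h1.continuous h2 (Lp.memLp _)
    · exact integrable_smul_of_compactSupport hd h2.deriv (ι.comp_memLp' (Lp.memLp _))
    · exact integrable_smul_of_compactSupport hd h2.deriv (ι.comp_memLp' (Lp.memLp _))
  smul_mem' := by
    intro c x hx φ h1 h2 h3
    have hx := hx φ h1 h2 h3
    have e1 : ∫ s in Ici (0 : ℝ), deriv φ s • ι ((c • x).fst s)
        = ∫ s in Ici (0 : ℝ), c • (deriv φ s • ι (x.fst s)) := by
      apply integral_congr_ae
      filter_upwards [Lp.coeFn_smul c x.fst] with s hs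
      simp only [WithLp.smul_fst, hs, Pi.smul_apply, map_smul]
      rw [smul_comm]
    have e2 : ∫ s in Ici (0 : ℝ), φ s • ((c • x).snd s)
        = ∫ s in Ici (0 : ℝ), c • (φ s • x.snd s) := by
      apply integral_congr_ae
      filter_upwards [Lp.coeFn_smul c x.snd] with s hs
      simp only [WithLp.smul_snd, hs, Pi.smul_apply]
      rw [smul_comm]
    rw [e1, e2, integral_smul, integral_smul, hx, smul_neg]

/-- The underlying path `ξ ∈ L²(ℝ₊, H₁)`. -/
def path {ι : H₁ →L[ℝ] H₀} (ξ : P1 ι) : Lp H₁ 2 halfLine := ξ.1.fst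

/-- The weak derivative `∂ₛξ ∈ L²(ℝ₊, H₀)`. -/
def weakDeriv {ι : H₁ →L[ℝ] H₀} (ξ : P1 ι) : Lp H₀ 2 halfLine := ξ.1.snd

/-- The formula for the norm of `P₁(ℝ₊)`. -/
theorem P1.norm_sq {ι : H₁ →L[ℝ] H₀} (ξ : P1 ι) :
    ‖ξ‖ ^ 2 = ‖path ξ‖ ^ 2 + ‖weakDeriv ξ‖ ^ 2 :=
  WithLp.prod_norm_sq_eq_of_L2 ξ.1

/-- The `P₀([0, T])`-norm of a path. -/
def normP0On (ι : H₁ →L[ℝ] H₀) (T : ℝ) (ξ : P1 ι) : ℝ :=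
  √(∫ s in Icc (0 : ℝ) T, ‖ι (path ξ s)‖ ^ 2)

/-- `x ∈ H₀` is the value `ξ(0)`, that is, the value at `0` of the continuous representative
`[0, ∞) → H₀` of `ξ`. -/
def IsValueAtZero {ι : H₁ →L[ℝ] H₀} (ξ : P1 ι) (x : H₀) : Prop :=
  ∃ f : ℝ → H₀, ContinuousOn f (Ici 0) ∧ f =ᵐ[halfLine] (fun s => ι (path ξ s)) ∧ f 0 = x

/-! ### The operator `D_A` -/

theorem IsHessianPath.exists_bound {ι : H₁ →L[ℝ] H₀} {A : ℝ → H₁ →L[ℝ] H₀}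
    (hA : IsHessianPath ι A) : ∃ C : ℝ, ∀ s, 0 ≤ s → ‖A s‖ ≤ C := by
  obtain ⟨Ap, hlim, -, -⟩ := hA.exists_limit
  have h1 : ∀ᶠ s in atTop, ‖A s‖ ≤ ‖Ap‖ + 1 :=
    (hlim.norm.eventually (gt_mem_nhds (lt_add_one _))).mono fun s hs => le_of_lt hs
  obtain ⟨R, hR⟩ := eventually_atTop.mp h1
  obtain ⟨C, hC⟩ := isCompact_Icc.exists_bound_of_continuousOn
    (hA.continuousOn.mono (Icc_subset_Ici_self : Icc (0 : ℝ) R ⊆ Ici 0))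
  refine ⟨max C (‖Ap‖ + 1), fun s hs => ?_⟩
  rcases le_total s R with h | h
  · exact (hC s ⟨hs, h⟩).trans (le_max_left _ _)
  · exact (hR s h).trans (le_max_right _ _)

theorem IsHessianPath.memLp {ι : H₁ →L[ℝ] H₀} {A : ℝ → H₁ →L[ℝ] H₀}
    (hA : IsHessianPath ι A) (u : Lp H₁ 2 halfLine) :
    MemLp (fun s => A s (u s)) 2 halfLine := by
  obtain ⟨C, hC⟩ := hA.exists_bound
  have hm : AEStronglyMeasurable A halfLine :=
    hA.continuousOn.aestronglyMeasurable measurableSet_Ici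
  refine MemLp.of_le_mul (c := C) (Lp.memLp u)
    (isBoundedBilinearMap_apply.continuous.comp_aestronglyMeasurable
      (hm.prodMk (Lp.aestronglyMeasurable u))) ?_
  filter_upwards [ae_restrict_mem measurableSet_Ici] with s hs
  exact (A s).le_of_opNorm_le (hC s hs) _

/-- The operator `D_A : P₁(ℝ₊) → P₀(ℝ₊)`, `D_A ξ = ∂ₛξ + A ξ`. -/
def DOp {ι : H₁ →L[ℝ] H₀} {A : ℝ → H₁ →L[ℝ] H₀} (hA : IsHessianPath ι A) (ξ : P1 ι) : P0 H₀ :=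
  weakDeriv ξ + (hA.memLp (path ξ)).toLp

/-! ### The interpolation space `H_{1/2}` -/

/-- The growth operator `T : H₁ → H₁` of the pair, `⟨ι ξ, ι η⟩₀ = ⟨ξ, T η⟩₁`. -/
def growthOp (ι : H₁ →L[ℝ] H₀) : H₁ →L[ℝ] H₁ := ι.adjoint ∘L ι

theorem inner_growthOp (ι : H₁ →L[ℝ] H₀) (x y : H₁) :
    inner ℝ (ι x) (ι y) = inner ℝ x (growthOp ι y) := by
  simp [growthOp, ContinuousLinearMap.adjoint_inner_right]

/-- The eigenvalues `κ` of the growth operator. -/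
abbrev GrowthEigenvalues (ι : H₁ →L[ℝ] H₀) : Type :=
  Module.End.Eigenvalues (growthOp ι : Module.End ℝ H₁)

/-- The eigenspace `V_κ ⊂ H₁` of the growth operator, as a subspace of `H₀`. It is finite
dimensional for a Hilbert space pair, so that taking the closure does not change it. -/
def coreEigenspace (ι : H₁ →L[ℝ] H₀) (κ : ℝ) : Submodule ℝ H₀ :=
  ((Module.End.eigenspace (growthOp ι : Module.End ℝ H₁) κ).map
    (ι : H₁ →ₗ[ℝ] H₀)).topologicalClosure

instance (ι : H₁ →L[ℝ] H₀) (κ : ℝ) : CompleteSpace (coreEigenspace ι κ) :=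
  (Submodule.isClosed_topologicalClosure _).completeSpace_coe

/-- The component `x_κ` of `x ∈ H₀` in `V_κ`. -/
def component (ι : H₁ →L[ℝ] H₀) (κ : ℝ) : H₀ →L[ℝ] H₀ := (coreEigenspace ι κ).starProjection

/-- The weighted component `κ^{-1/4} x_κ`. -/
def weighted (ι : H₁ →L[ℝ] H₀) (x : H₀) (κ : GrowthEigenvalues ι) : H₀ :=
  ((κ : ℝ) ^ (-(1 / 4) : ℝ)) • component ι κ x

/-- The subspace `H_{1/2} ⊂ H₀` of all `x` with `∑_κ κ^{-1/2} ‖x_κ‖₀² < ∞`. -/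
def halfSubmodule (ι : H₁ →L[ℝ] H₀) : Submodule ℝ H₀ where
  carrier := {x | Memℓp (weighted ι x) 2}
  zero_mem' := by
    have : weighted ι 0 = 0 := by ext κ; simp [weighted]
    simp only [mem_ofPred_eq, this]
    exact zero_memℓp
  add_mem' := by
    intro x y hx hy
    have : weighted ι (x + y) = weighted ι x + weighted ι y := by ext κ; simp [weighted]
    simp only [mem_ofPred_eq, this]
    exact Memℓp.add hx hy
  smul_mem' := by
    intro c x hx
    have : weighted ι (c • x) = c • weighted ι x := by
      ext κ; simp only [weighted, map_smul, Pi.smul_apply]; exact smul_comm _ _ _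
    simp only [mem_ofPred_eq, this]
    exact Memℓp.const_smul hx c

/-- The interpolation space `H_{1/2}`, with its own norm (defined below). -/
def HHalf (ι : H₁ →L[ℝ] H₀) : Type _ := halfSubmodule ι

instance (ι : H₁ →L[ℝ] H₀) : AddCommGroup (HHalf ι) :=
  inferInstanceAs (AddCommGroup (halfSubmodule ι))

instance (ι : H₁ →L[ℝ] H₀) : Module ℝ (HHalf ι) :=
  inferInstanceAs (Module ℝ (halfSubmodule ι))

/-- The inclusion `H_{1/2} ⊂ H₀`. -/
def HHalf.incl (ι : H₁ →L[ℝ] H₀) : HHalf ι →ₗ[ℝ] H₀ := (halfSubmodule ι).subtype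

/-- The map `x ↦ (κ^{-1/4} x_κ)_κ` from `H_{1/2}` to `ℓ²`. -/
def HHalf.toSeq (ι : H₁ →L[ℝ] H₀) :
    HHalf ι →ₗ[ℝ] lp (fun _ : GrowthEigenvalues ι => H₀) 2 where
  toFun x := ⟨weighted ι (HHalf.incl ι x), x.2⟩
  map_add' x y := by
    ext κ
    change weighted ι (HHalf.incl ι (x + y)) κ = weighted ι (HHalf.incl ι x) κ
      + weighted ι (HHalf.incl ι y) κ
    simp only [weighted, map_add, smul_add]
  map_smul' c x := by
    ext κ
    change weighted ι (HHalf.incl ι (c • x)) κ = c • weighted ι (HHalf.incl ι x) κ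
    simp only [weighted, map_smul]
    exact smul_comm _ _ _

/-- An element of `H₀` all of whose components vanish is zero. -/
theorem eq_zero_of_component_eq_zero (ι : H₁ →L[ℝ] H₀) [HilbertPair ι] (x : H₀)
    (hx : ∀ κ : GrowthEigenvalues ι, component ι κ x = 0) : x = 0 := by
  have hsym : (growthOp ι).IsSymmetric := by
    intro a b
    change inner ℝ (growthOp ι a) b = inner ℝ a (growthOp ι b)
    rw [← inner_growthOp, real_inner_comm, ← inner_growthOp, real_inner_comm]
  have hcomp : IsCompactOperator (growthOp ι) :=
    (HilbertPair.compact (ι := ι)).clm_comp ι.adjoint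
  have hbot := ContinuousLinearMap.orthogonalComplement_iSup_eigenspaces_eq_bot hcomp hsym
  have hmem : ι.adjoint x ∈
      (⨆ μ, Module.End.eigenspace (growthOp ι : Module.End ℝ H₁) μ)ᗮ := by
    rw [Submodule.mem_orthogonal]
    intro u hu
    induction hu using Submodule.iSup_induction' with
    | mem κ v hv =>
      rw [ContinuousLinearMap.adjoint_inner_right]
      by_cases h : Module.End.HasEigenvalue (growthOp ι : Module.End ℝ H₁) κ
      · have h0 := hx ⟨κ, h⟩
        have hperp : x ∈ (coreEigenspace ι κ)ᗮ := by
          rw [← Submodule.ker_starProjection]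
          exact h0
        exact hperp _ (Submodule.le_topologicalClosure _ (Submodule.mem_map_of_mem hv))
      · have hv0 : v = 0 := by
          by_contra hne
          exact h (Module.End.hasEigenvalue_of_hasEigenvector ⟨hv, hne⟩)
        simp [hv0]
    | zero => simp
    | add a b _ _ ha hb => rw [inner_add_left, ha, hb, add_zero]
  rw [hbot, Submodule.mem_bot] at hmem
  have hz : ∀ y : H₀, inner ℝ x y = 0 := by
    intro y
    refine (HilbertPair.denseRange (ι := ι)).induction_on y ?_ ?_
    · exact isClosed_eq (by fun_prop) continuous_const
    · intro a
      rw [← ContinuousLinearMap.adjoint_inner_left, hmem, inner_zero_left]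
  exact inner_self_eq_zero.mp (hz x)

theorem HHalf.toSeq_injective (ι : H₁ →L[ℝ] H₀) [HilbertPair ι] :
    Function.Injective (HHalf.toSeq ι) := by
  rw [injective_iff_map_eq_zero]
  intro x hx
  apply Subtype.ext
  refine eq_zero_of_component_eq_zero ι _ fun κ => ?_
  have h : weighted ι (HHalf.incl ι x) κ = 0 := by
    exact congrArg (fun z : lp (fun _ : GrowthEigenvalues ι => H₀) 2 => z κ) hx
  rcases smul_eq_zero.mp h with h0 | h0
  · exfalso
    have hpos : 0 < (κ : ℝ) := by
      obtain ⟨v, hv⟩ := Module.End.HasEigenvalue.exists_hasEigenvector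
        (show Module.End.HasEigenvalue (growthOp ι : Module.End ℝ H₁) κ from κ.property)
      have e : growthOp ι v = (κ : ℝ) • v := hv.apply_eq_smul
      have h1 := inner_growthOp ι v v
      rw [e, real_inner_smul_right, real_inner_self_eq_norm_sq, real_inner_self_eq_norm_sq] at h1
      have h2 : 0 < ‖v‖ ^ 2 := by have := norm_pos_iff.mpr hv.2; positivity
      have h3 : 0 < ‖ι v‖ ^ 2 := by
        have : ι v ≠ 0 := fun h => hv.2 (HilbertPair.injective (ι := ι) (by simpa using h))
        have := norm_pos_iff.mpr this
        positivity
      rw [h1] at h3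
      exact pos_of_mul_pos_left h3 h2.le
    exact (Real.rpow_pos_of_pos hpos _).ne' h0
  · exact h0

instance (ι : H₁ →L[ℝ] H₀) [HilbertPair ι] : NormedAddCommGroup (HHalf ι) :=
  NormedAddCommGroup.induced _ _ (HHalf.toSeq ι) (HHalf.toSeq_injective ι)

instance (ι : H₁ →L[ℝ] H₀) [HilbertPair ι] : NormedSpace ℝ (HHalf ι) :=
  NormedSpace.induced ℝ (HHalf ι) _ (HHalf.toSeq ι)

/-! ### Spectral projections -/

/-- `H⁺_{1/2}(A)`: the closure in `H_{1/2}` of the span of the eigenvectors of `A` for positive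
eigenvalues. -/
def HPlus (ι : H₁ →L[ℝ] H₀) [HilbertPair ι] (A : H₁ →L[ℝ] H₀) : Submodule ℝ (HHalf ι) :=
  (Submodule.span ℝ {x : HHalf ι | ∃ (v : H₁) (a : ℝ), 0 < a ∧ A v = a • ι v ∧
    HHalf.incl ι x = ι v}).topologicalClosure

/-- `H⁻_{1/2}(A)`: the closure in `H_{1/2}` of the span of the eigenvectors of `A` for negative
eigenvalues. -/
def HMinus (ι : H₁ →L[ℝ] H₀) [HilbertPair ι] (A : H₁ →L[ℝ] H₀) : Submodule ℝ (HHalf ι) :=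
  (Submodule.span ℝ {x : HHalf ι | ∃ (v : H₁) (a : ℝ), a < 0 ∧ A v = a • ι v ∧
    HHalf.incl ι x = ι v}).topologicalClosure

/-- `π₊^A`: the projection of `H_{1/2}` onto `H⁺_{1/2}(A)` along `H⁻_{1/2}(A)`, for complementary
subspaces. -/
def projPlus (ι : H₁ →L[ℝ] H₀) [HilbertPair ι] (A : H₁ →L[ℝ] H₀)
    (h : IsCompl (HPlus ι A) (HMinus ι A)) : HHalf ι →ₗ[ℝ] HHalf ι :=
  (HPlus ι A).projection (HMinus ι A) h

/-- The `H_{1/2}`-norm. -/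
theorem HHalf.norm_sq (ι : H₁ →L[ℝ] H₀) [HilbertPair ι] (x : HHalf ι) :
    ‖x‖ ^ 2 = ∑' κ : GrowthEigenvalues ι,
      ((κ : ℝ) ^ (-(1 / 4) : ℝ)) ^ 2 * ‖component ι κ (HHalf.incl ι x)‖ ^ 2 := by
  have h : ‖x‖ = ‖HHalf.toSeq ι x‖ := rfl
  have h2 := lp.norm_rpow_eq_tsum (p := 2) (by norm_num) (HHalf.toSeq ι x)
  rw [h]
  simp only [ENNReal.toReal_ofNat, Real.rpow_ofNat] at h2
  rw [h2]
  refine tsum_congr fun κ => ?_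
  change ‖weighted ι (HHalf.incl ι x) κ‖ ^ 2 = _
  rw [weighted, norm_smul, mul_pow, Real.norm_eq_abs, sq_abs]

end HessianPath

end

/-! For a constant invertible `A` everything reduces to scalar equations. The inverse of `A`,
composed with `ι`, is compact, injective and symmetric for the equivalent inner product, so `A` has
an eigenbasis, which is a Riesz basis of `H₀` and, after division by `|aᵢ|`, of `H₁`
(`exists_spectralBasis`). In a coordinate `x` with eigenvalue `a`, expanding the square and using `2
∫ x x' = -x(0)²` gives `∫ (x')² + ∫ (a x)² = ∫ (x' + a x)² + a x(0)²`. Negative eigenvalues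
contribute a boundary term of the good sign, so only the positive part of `ξ(0)`, weighted by `a`,
has to be paid for. Summation over the basis yields the half line estimate
(`SpectralBasis.sum_component_le`, `exists_halfLine_estimate`).

That boundary term has to be recognized in `H_{1/2}`, which is defined by the growth operator and
not by `A`. The trace method does this: a path in `P₁` has a trace of finite energy with respect to
every weighted basis (`sum_trace_le`), and conversely a finite sum of basis vectors is the trace of
the path `exp(-sB) x`, whose `P₁` norm is its energy up to a constant. Hence all weighted bases of
the pair, that of the growth operator included, define equivalent norms (`WeightedBasis.energy_le`).
In the eigenbasis of `A(0)` the spaces `H^±_{1/2}` become coordinate subspaces, which gives the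
splitting and the bound of the boundary term by the projection.

For a path of operators the coefficients are frozen. Near `s₀` the operator `A(s)` is close to
`A(s₀)` in norm, so the difference is absorbed. If `A(s₀)` is not invertible, adding a projection
`Q` to its kernel makes it so, by symmetry and index zero (`IsHessian.exists_correction`). Both `Q`
and the derivative of a cutoff function produce errors of order zero, measured in `H₀` only. Away
from `0` the cutoff kills the trace, and near infinity the invertible limit needs no `Q`; so all
such errors live on a bounded interval `[0, T]`. Compactness leaves finitely many local estimates to
add up. -/

noncomputable section

namespace HessianPath

variable {H₀ H₁ : Type*}
  [NormedAddCommGroup H₀] [InnerProductSpace ℝ H₀] [CompleteSpace H₀]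
  [NormedAddCommGroup H₁] [InnerProductSpace ℝ H₁] [CompleteSpace H₁]

set_option linter.unusedSectionVars false

universe u v

/-! ### Primitives on the half line -/

/-- Integration by parts for primitives of integrable functions. -/
theorem integral_primitive_mul {f f' g g' : ℝ → ℝ} {b : ℝ} (hb : 0 ≤ b)
    (hf' : IntervalIntegrable f' volume 0 b) (hg' : IntervalIntegrable g' volume 0 b)
    (hf : ∀ s ∈ Icc 0 b, f s = f 0 + ∫ t in (0 : ℝ)..s, f' t)
    (hg : ∀ s ∈ Icc 0 b, g s = g 0 + ∫ t in (0 : ℝ)..s, g' t) :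
    ∫ x in (0 : ℝ)..b, (f' x * g x + f x * g' x) = f b * g b - f 0 * g 0 := by
  -- A primitive of an integrable function is absolutely continuous, but has that function as
  -- derivative only almost everywhere; this is enough for integration by parts. The given `f` and
  -- `g` agree with such primitives only on `[0, b]`.
  have key : ∀ {k k' : ℝ → ℝ}, IntervalIntegrable k' volume 0 b →
      AbsolutelyContinuousOnInterval (fun s => k 0 + ∫ t in (0 : ℝ)..s, k' t) 0 b ∧
      ∀ᵐ x, x ∈ uIcc 0 b → deriv (fun s => k 0 + ∫ t in (0 : ℝ)..s, k' t) x = k' x := by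
    intro k k' hk
    refine ⟨?_, ?_⟩
    · have h1 : AbsolutelyContinuousOnInterval (fun _ : ℝ => k 0) 0 b :=
        contDiffOn_const.absolutelyContinuousOnInterval
      exact h1.fun_add (hk.absolutelyContinuousOnInterval_intervalIntegral left_mem_uIcc)
    · filter_upwards [hk.ae_hasDerivAt_integral] with x hx hxm
      exact ((hx hxm 0 left_mem_uIcc).const_add _).deriv
  obtain ⟨aF, dF⟩ := key (k := f) hf'
  obtain ⟨aG, dG⟩ := key (k := g) hg'
  have h := aF.integral_deriv_mul_eq_sub aG
  simp only [intervalIntegral.integral_same, add_zero] at h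
  rw [← hf b (right_mem_Icc.2 hb), ← hg b (right_mem_Icc.2 hb)] at h
  rw [← h]
  apply intervalIntegral.integral_congr_ae
  filter_upwards [dF, dG] with x h1 h2 hx
  have hx' := uIoc_subset_uIcc hx
  have hx'' : x ∈ Icc 0 b := by rwa [uIcc_of_le hb] at hx'
  rw [h1 hx', h2 hx', ← hf x hx'', ← hg x hx'']

theorem MemLp.intervalIntegrable_halfLine {E : Type*} [NormedAddCommGroup E] {v : ℝ → E}
    (hv : MemLp v 2 halfLine) {a b : ℝ} (ha : 0 ≤ a) (hb : 0 ≤ b) :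
    IntervalIntegrable v volume a b := by
  rw [intervalIntegrable_iff]
  have hsub : uIoc a b ⊆ Ici 0 := by
    intro x hx
    rw [mem_uIoc] at hx
    rcases hx with h | h
    · exact ha.trans h.1.le
    · exact hb.trans h.1.le
  have h1 : MemLp v 2 (volume.restrict (uIoc a b)) :=
    hv.mono_measure (Measure.restrict_mono hsub le_rfl)
  have : IsFiniteMeasure (volume.restrict (uIoc a b)) := ⟨by simp [uIoc]⟩
  exact h1.integrable (by norm_num)

/-- The boundary term of a square integrable path on the half line with square integrable
derivative. -/
theorem integral_mul_deriv_halfLine {u g : ℝ → ℝ} (hu : MemLp u 2 halfLine)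
    (hg : MemLp g 2 halfLine) (hug : ∀ s, 0 ≤ s → u s = u 0 + ∫ t in (0 : ℝ)..s, g t) :
    Integrable (fun s => u s * g s) halfLine ∧
      2 * ∫ s in Ici (0 : ℝ), u s * g s = -(u 0) ^ 2 := by
  have hint : Integrable (fun s => u s * g s) halfLine := hu.integrable_mul hg
  refine ⟨hint, ?_⟩
  have hsq : Integrable (fun s => u s ^ 2) halfLine := hu.integrable_sq
  have hid : ∀ b, 0 ≤ b → u b ^ 2 = u 0 ^ 2 + 2 * ∫ s in (0 : ℝ)..b, u s * g s := by
    intro b hb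
    have hgi := MemLp.intervalIntegrable_halfLine hg le_rfl hb
    have h := integral_primitive_mul hb hgi hgi (fun s hs => hug s hs.1) (fun s hs => hug s hs.1)
    have h2 : ∫ x in (0 : ℝ)..b, (g x * u x + u x * g x) = 2 * ∫ s in (0 : ℝ)..b, u s * g s := by
      rw [← intervalIntegral.integral_const_mul]
      congr 1 with x
      ring
    rw [h2] at h
    linarith
  have hint' : IntegrableOn (fun s => u s * g s) (Ioi 0) := hint.mono_measure
    (Measure.restrict_mono Ioi_subset_Ici_self le_rfl)
  have hlim : Tendsto (fun b => u b ^ 2) atTop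
      (𝓝 (u 0 ^ 2 + 2 * ∫ s in Ioi (0 : ℝ), u s * g s)) := by
    have := ((intervalIntegral_tendsto_integral_Ioi 0 hint' tendsto_id).const_mul 2).const_add
      (u 0 ^ 2)
    refine this.congr' ?_
    filter_upwards [eventually_ge_atTop 0] with b hb
    exact (hid b hb).symm
  -- `u²` has a limit at infinity because `u g` is integrable. Since `u²` is integrable over a set
  -- of infinite measure, the limit is zero.
  have hz : u 0 ^ 2 + 2 * ∫ s in Ioi (0 : ℝ), u s * g s = 0 := by
    refine IntegrableAtFilter.eq_zero_of_tendsto (μ := volume) (l := atTop)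
      ⟨Ici 0, mem_atTop 0, hsq⟩ ?_ hlim
    intro s hs
    obtain ⟨a, ha⟩ := mem_atTop_sets.1 hs
    exact top_unique ((Real.volume_Ici (a := a)).ge.trans (measure_mono ha))
  rw [integral_Ici_eq_integral_Ioi]
  linarith

/-! ### Weak derivatives on the half line -/

/-- `v` is the weak derivative of `g` on the half line. -/
def HasWeakDeriv {E : Type*} [NormedAddCommGroup E] [NormedSpace ℝ E] (g v : ℝ → E) : Prop :=
  ∀ φ : ℝ → ℝ, ContDiff ℝ ∞ φ → HasCompactSupport φ → tsupport φ ⊆ Ioi 0 →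
    ∫ s in Ici (0 : ℝ), deriv φ s • g s = - ∫ s in Ici (0 : ℝ), φ s • v s

theorem exists_bound_of_hasCompactSupport {φ : ℝ → ℝ} (hc : HasCompactSupport φ) :
    ∃ b, 0 ≤ b ∧ ∀ s, b ≤ s → φ s = 0 := by
  obtain ⟨b, hb⟩ := hc.isCompact.isBounded.bddAbove
  refine ⟨max 0 (b + 1), le_max_left _ _, fun s hs => image_eq_zero_of_notMem_tsupport fun h => ?_⟩
  have := hb h
  have := (le_max_right 0 (b + 1)).trans hs
  linarith

theorem setIntegral_Ici_eq_interval {E : Type*} [NormedAddCommGroup E] [NormedSpace ℝ E]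
    {f : ℝ → E} {b : ℝ} (hb : 0 ≤ b) (h : ∀ s, b ≤ s → f s = 0) :
    ∫ s in Ici (0 : ℝ), f s = ∫ s in (0 : ℝ)..b, f s := by
  rw [intervalIntegral.integral_of_le hb, integral_Ici_eq_integral_Ioi]
  refine setIntegral_eq_of_subset_of_forall_sdiff_eq_zero measurableSet_Ioi Ioc_subset_Ioi_self ?_
  intro s hs
  apply h
  by_contra hlt
  exact hs.2 ⟨hs.1, (not_le.1 hlt).le⟩

theorem continuousOn_primitive_halfLine {E : Type*} [NormedAddCommGroup E] [NormedSpace ℝ E]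
    {v : ℝ → E} (hv : MemLp v 2 halfLine) :
    ContinuousOn (fun s => ∫ t in (0 : ℝ)..s, v t) (Ici 0) := by
  intro s hs
  have hs : 0 ≤ s := hs
  have hi : IntegrableOn v (uIcc 0 (s + 1)) := by
    rw [uIcc_of_le (by linarith), ← intervalIntegrable_iff_integrableOn_Icc_of_le (by linarith)]
    exact MemLp.intervalIntegrable_halfLine hv le_rfl (by linarith)
  have h := (intervalIntegral.continuousOn_primitive_interval hi) s
    (by rw [uIcc_of_le (by linarith)]; exact ⟨hs, by linarith⟩)
  refine h.mono_of_mem_nhdsWithin ?_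
  rw [uIcc_of_le (by linarith), ← Ici_inter_Iic]
  exact inter_mem self_mem_nhdsWithin (mem_nhdsWithin_of_mem_nhds (Iic_mem_nhds (by linarith)))

/-- The primitive of a square integrable function has that function as its weak derivative. -/
theorem hasWeakDeriv_primitive {v : ℝ → H₀} (hv : MemLp v 2 halfLine) :
    HasWeakDeriv (fun s => ∫ t in (0 : ℝ)..s, v t) v := by
  intro φ hφ hc hsupp
  obtain ⟨b, hb, hφb⟩ := exists_bound_of_hasCompactSupport hc
  obtain ⟨b', hb', hφb'⟩ := exists_bound_of_hasCompactSupport hc.deriv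
  set c := max b b'
  have hc0 : 0 ≤ c := hb.trans (le_max_left _ _)
  have hd : Continuous (deriv φ) := hφ.continuous_deriv (by simp)
  rw [setIntegral_Ici_eq_interval hc0 (fun s hs => by
      rw [hφb' s ((le_max_right _ _).trans hs), zero_smul]),
    setIntegral_Ici_eq_interval hc0 (fun s hs => by
      rw [hφb s ((le_max_left _ _).trans hs), zero_smul])]
  have hvi : IntervalIntegrable v volume 0 c := MemLp.intervalIntegrable_halfLine hv le_rfl hc0
  have hFc : ContinuousOn (fun s => ∫ t in (0 : ℝ)..s, v t) (uIcc 0 c) := by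
    rw [uIcc_of_le hc0]
    exact (continuousOn_primitive_halfLine hv).mono Icc_subset_Ici_self
  have i1 : IntervalIntegrable (fun s => deriv φ s • ∫ t in (0 : ℝ)..s, v t) volume 0 c :=
    (hd.continuousOn.smul hFc).intervalIntegrable
  have i2 : IntervalIntegrable (fun s => φ s • v s) volume 0 c :=
    hvi.continuousOn_smul hφ.continuous.continuousOn
  -- Pairing with a fixed vector reduces the claim to real functions, where integration by parts for
  -- primitives applies.
  refine ext_inner_left ℝ fun y => ?_
  rw [inner_neg_right]
  have e1 : inner ℝ y (∫ s in (0 : ℝ)..c, deriv φ s • ∫ t in (0 : ℝ)..s, v t)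
      = ∫ s in (0 : ℝ)..c, deriv φ s * ∫ t in (0 : ℝ)..s, inner ℝ y (v t) := by
    rw [← innerSL_apply_apply (𝕜 := ℝ), ← ContinuousLinearMap.intervalIntegral_comp_comm _ i1]
    apply intervalIntegral.integral_congr
    intro s hs
    rw [uIcc_of_le hc0] at hs
    simp only [innerSL_apply_apply, inner_smul_right]
    congr 1
    rw [← innerSL_apply_apply (𝕜 := ℝ), ← ContinuousLinearMap.intervalIntegral_comp_comm _
      (MemLp.intervalIntegrable_halfLine hv le_rfl hs.1)]
    simp
  have e2 : inner ℝ y (∫ s in (0 : ℝ)..c, φ s • v s)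
      = ∫ s in (0 : ℝ)..c, φ s * inner ℝ y (v s) := by
    rw [← innerSL_apply_apply (𝕜 := ℝ), ← ContinuousLinearMap.intervalIntegral_comp_comm _ i2]
    apply intervalIntegral.integral_congr
    intro s hs
    simp only [innerSL_apply_apply, inner_smul_right]
  rw [e1, e2]
  have hyv : IntervalIntegrable (fun t => inner ℝ y (v t)) volume 0 c :=
    MemLp.intervalIntegrable_halfLine ((innerSL ℝ y).comp_memLp' hv) le_rfl hc0
  have hcy : ContinuousOn (fun s => ∫ t in (0 : ℝ)..s, inner ℝ y (v t)) (uIcc 0 c) := by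
    rw [uIcc_of_le hc0]
    exact (continuousOn_primitive_halfLine ((innerSL ℝ y).comp_memLp' hv)).mono
      Icc_subset_Ici_self
  have h := integral_primitive_mul (f := φ) (f' := deriv φ)
    (g := fun s => ∫ t in (0 : ℝ)..s, inner ℝ y (v t)) (g' := fun t => inner ℝ y (v t)) hc0
    (hd.intervalIntegrable _ _) hyv (fun s _ => by
      rw [intervalIntegral.integral_deriv_eq_sub (fun x _ =>
        (hφ.differentiable (by simp)).differentiableAt) (hd.intervalIntegrable _ _)]
      ring) (fun s _ => by simp)
  have i3 : IntervalIntegrable (fun s => deriv φ s * ∫ t in (0 : ℝ)..s, inner ℝ y (v t))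
      volume 0 c := (hd.continuousOn.mul hcy).intervalIntegrable
  rw [intervalIntegral.integral_add i3
      (hyv.continuousOn_mul hφ.continuous.continuousOn), hφb c (le_max_left _ _)] at h
  simp only [intervalIntegral.integral_same] at h
  linarith

/-- A locally integrable function on the half line with vanishing weak derivative is constant. -/
theorem ae_eq_const_of_weakDeriv_zero {h : ℝ → H₀}
    (hloc : ∀ g : ℝ → ℝ, Continuous g → HasCompactSupport g →
      Integrable (fun s => g s • h s) halfLine)
    (hl : LocallyIntegrableOn h (Ioi 0) halfLine)
    (hw : ∀ φ : ℝ → ℝ, ContDiff ℝ ∞ φ → HasCompactSupport φ → tsupport φ ⊆ Ioi 0 →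
      ∫ s in Ici (0 : ℝ), deriv φ s • h s = 0) :
    ∃ c : H₀, ∀ᵐ s ∂halfLine, h s = c := by
  -- The du Bois-Reymond argument. Any bump of integral one with compact support in the open half
  -- line would serve; this one lives on `[1, 3]`, and the constant is the average of `h` against
  -- it.
  let B : ContDiffBump (2 : ℝ) := ⟨1 / 2, 1, by norm_num, by norm_num⟩
  set ψ : ℝ → ℝ := B.normed volume
  have hψ1 : ContDiff ℝ ∞ ψ := B.contDiff_normed
  have hψ2 : HasCompactSupport ψ := B.hasCompactSupport_normed
  have hψ3 : tsupport ψ = Metric.closedBall 2 1 := B.tsupport_normed_eq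
  have hψ4 : ∫ s, ψ s = 1 := B.integral_normed
  set c := ∫ s in Ici (0 : ℝ), ψ s • h s
  refine ⟨c, ?_⟩
  have key : ∀ᵐ s ∂halfLine, s ∈ Ioi (0 : ℝ) → h s - c = 0 := by
    refine isOpen_Ioi.ae_eq_zero_of_integral_contDiff_smul_eq_zero
      (hl.sub ((locallyIntegrable_const c).locallyIntegrableOn _)) ?_
    intro η hη1 hη2 hη3
    have hK : IsCompact (tsupport η ∪ tsupport ψ) := hη2.isCompact.union hψ2.isCompact
    have hKsub : tsupport η ∪ tsupport ψ ⊆ Ioi 0 := by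
      refine union_subset hη3 ?_
      rw [hψ3, Real.closedBall_eq_Icc]
      intro x hx
      have := hx.1
      simp only [mem_Ioi]
      linarith
    obtain ⟨b, hb⟩ := hK.isBounded.bddAbove
    obtain ⟨a, ha0, ha⟩ : ∃ a : ℝ, 0 < a ∧ ∀ x ∈ tsupport η ∪ tsupport ψ, a ≤ x := by
      rcases (tsupport η ∪ tsupport ψ).eq_empty_or_nonempty with he | hne
      · exact ⟨1, one_pos, fun x hx => by simp [he] at hx⟩
      · obtain ⟨a, ha, hmin⟩ := hK.exists_isLeast hne
        exact ⟨a, hKsub ha, fun x hx => hmin hx⟩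
    set m := ∫ s, η s
    -- Subtracting `m ψ` makes the integral vanish, which is exactly what gives the primitive `φ` of
    -- `θ` compact support. Testing with `φ` then says `∫ η h = (∫ η) c`.
    set θ : ℝ → ℝ := fun s => η s - m * ψ s
    have hθc : ContDiff ℝ ∞ θ := hη1.sub (contDiff_const.mul hψ1)
    have hθ0 : ∀ s, s ∉ tsupport η ∪ tsupport ψ → θ s = 0 := by
      intro s hs
      simp only [mem_union, not_or] at hs
      simp [θ, image_eq_zero_of_notMem_tsupport hs.1, image_eq_zero_of_notMem_tsupport hs.2]
    have hηi : Integrable η := hη1.continuous.integrable_of_hasCompactSupport hη2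
    have hψi : Integrable ψ := hψ1.continuous.integrable_of_hasCompactSupport hψ2
    have hθint : ∫ s, θ s = 0 := by
      simp only [θ]
      rw [integral_sub hηi (hψi.const_mul m), integral_const_mul, hψ4]
      simp [m]
    set φ : ℝ → ℝ := fun s => ∫ t in (0 : ℝ)..s, θ t
    have hφd : ∀ s, HasDerivAt φ (θ s) s := fun s =>
      (hθc.continuous.integral_hasStrictDerivAt 0 s).hasDerivAt
    have hφ' : deriv φ = θ := funext fun s => (hφd s).deriv
    have hφc : ContDiff ℝ ∞ φ := by
      rw [contDiff_infty_iff_deriv]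
      exact ⟨fun s => (hφd s).differentiableAt, hφ' ▸ hθc⟩
    have hφa : ∀ s, s ≤ a → φ s = 0 := by
      intro s hs
      -- The endpoint `a` may belong to the supports; it is discarded below as a null set.
      have : ∀ t ∈ uIoc 0 s, θ t = 0 ∨ t = a := by
        intro t ht
        by_contra hcon
        push Not at hcon
        have hmem : t ∈ tsupport η ∪ tsupport ψ := by
          by_contra hn; exact hcon.1 (hθ0 t hn)
        have h1 := ha t hmem
        rw [mem_uIoc] at ht
        rcases ht with ht | ht
        · exact hcon.2 (le_antisymm (ht.2.trans hs) h1)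
        · linarith [ht.2]
      apply intervalIntegral.integral_zero_ae
      have hne : ∀ᵐ t : ℝ, t ≠ a := by simp [ae_iff, measure_singleton]
      filter_upwards [hne] with t ht hmem
      exact (this t hmem).resolve_right ht
    have hφb : ∀ s, b ≤ s → φ s = 0 := by
      intro s hs
      rcases (tsupport η ∪ tsupport ψ).eq_empty_or_nonempty with he | ⟨x, hx⟩
      · have : θ = 0 := funext fun t => hθ0 t (by simp [he])
        simp [φ, this]
      · have hs0 : 0 ≤ s := (ha0.le.trans (ha x hx)).trans ((hb hx).trans hs)
        rw [← hθint]
        simp only [φ]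
        rw [intervalIntegral.integral_of_le hs0]
        refine setIntegral_eq_integral_of_forall_compl_eq_zero fun t ht => hθ0 t fun hmem => ht ?_
        exact ⟨ha0.trans_le (ha t hmem), (hb hmem).trans hs⟩
    have hφs : tsupport φ ⊆ Icc a b := by
      refine closure_minimal ?_ isClosed_Icc
      intro s hs
      by_contra hn
      apply hs
      rcases le_total s a with h1 | h1
      · exact hφa s h1
      · refine hφb s ?_
        by_contra h2
        exact hn ⟨h1, (not_le.1 h2).le⟩
    have hz := hw φ hφc (isCompact_Icc.of_isClosed_subset (isClosed_tsupport _) hφs)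
      (hφs.trans fun x hx => ha0.trans_le hx.1)
    rw [hφ'] at hz
    have i1 := hloc η hη1.continuous hη2
    have i2 := hloc ψ hψ1.continuous hψ2
    have i3 : Integrable (fun s => m • ψ s • h s) halfLine := i2.smul m
    have e1 : ∫ s in Ici (0 : ℝ), θ s • h s = (∫ s in Ici (0 : ℝ), η s • h s) - m • c := by
      simp only [θ, sub_smul, mul_smul]
      rw [integral_sub i1 i3, integral_smul]
    have hm : ∫ s in Ici (0 : ℝ), η s = m := by
      refine setIntegral_eq_integral_of_forall_compl_eq_zero fun t ht => ?_
      refine image_eq_zero_of_notMem_tsupport fun hmem => ht ?_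
      exact (show (0 : ℝ) < t from hη3 hmem).le
    simp only [smul_sub]
    rw [integral_sub i1 ((hηi.restrict).smul_const c), integral_smul_const, hm, ← e1, hz]
  have h0 : ∀ᵐ s ∂halfLine, s ≠ 0 :=
    ae_restrict_of_ae (by simp [ae_iff, measure_singleton])
  filter_upwards [key, h0, ae_restrict_mem measurableSet_Ici] with s h1 h2 h3
  exact sub_eq_zero.1 (h1 (lt_of_le_of_ne h3 (Ne.symm h2)))

/-- A square integrable function on the half line with square integrable weak derivative is a
primitive of it. -/
theorem HasWeakDeriv.exists_primitive {g v : ℝ → H₀} (hg : MemLp g 2 halfLine)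
    (hv : MemLp v 2 halfLine) (h : HasWeakDeriv g v) :
    ∃ x : H₀, ∀ᵐ s ∂halfLine, g s = x + ∫ t in (0 : ℝ)..s, v t := by
  have hF := continuousOn_primitive_halfLine hv
  have i2 : ∀ φ : ℝ → ℝ, Continuous φ → HasCompactSupport φ →
      Integrable (fun s => φ s • ∫ t in (0 : ℝ)..s, v t) halfLine := by
    intro φ hφ hc
    have hcont : ContinuousOn (fun s => φ s • ∫ t in (0 : ℝ)..s, v t) (Ici 0) :=
      hφ.continuousOn.smul hF
    obtain ⟨b, hb, hφb⟩ := exists_bound_of_hasCompactSupport hc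
    have h1 : IntegrableOn (fun s => φ s • ∫ t in (0 : ℝ)..s, v t) (Icc 0 b) :=
      (hcont.mono Icc_subset_Ici_self).integrableOn_Icc
    refine h1.of_forall_sdiff_eq_zero measurableSet_Ici ?_
    intro s hs
    have hbs : b ≤ s := by
      by_contra hlt
      exact hs.2 ⟨hs.1, (not_le.1 hlt).le⟩
    rw [hφb s hbs, zero_smul]
  -- The difference of `g` and the primitive of `v` has weak derivative zero. A primitive need not
  -- be square integrable on the half line, so integrability is only claimed against compactly
  -- supported functions.
  obtain ⟨c, hc⟩ := ae_eq_const_of_weakDeriv_zero (h := fun s => g s - ∫ t in (0 : ℝ)..s, v t)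
    (fun φ hφ hc => by
      simp only [smul_sub]
      exact (integrable_smul_of_compactSupport hφ hc hg).sub (i2 φ hφ hc))
    (by
      refine LocallyIntegrableOn.sub ?_ ?_
      · exact (hg.locallyIntegrable (by norm_num)).locallyIntegrableOn _
      · intro s hs
        refine ⟨Icc 0 (s + 1), ?_, ?_⟩
        · refine mem_nhdsWithin_of_mem_nhds (Icc_mem_nhds hs (by linarith))
        · rw [IntegrableOn, Measure.restrict_restrict measurableSet_Icc,
            inter_eq_left.2 Icc_subset_Ici_self]
          exact (hF.mono Icc_subset_Ici_self).integrableOn_Icc)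
    (fun φ h1 h2 h3 => by
      have hd : Continuous (deriv φ) := h1.continuous_deriv (by simp)
      simp only [smul_sub]
      rw [integral_sub (integrable_smul_of_compactSupport hd h2.deriv hg) (i2 _ hd h2.deriv),
        h φ h1 h2 h3, hasWeakDeriv_primitive hv φ h1 h2 h3, sub_self])
  refine ⟨c, ?_⟩
  filter_upwards [hc] with s hs
  rw [← hs]
  abel

/-- Functions that are continuous on the half line and equal almost everywhere are equal. -/
theorem eqOn_Ici_of_ae_eq {f g : ℝ → H₀} (hf : ContinuousOn f (Ici 0))
    (hg : ContinuousOn g (Ici 0)) (h : f =ᵐ[halfLine] g) : EqOn f g (Ici 0) := by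
  have h1 : EqOn f g (Ioi 0) := by
    have h2 : f =ᵐ[volume.restrict (Ioi 0)] g :=
      ae_restrict_of_ae_restrict_of_subset Ioi_subset_Ici_self h
    exact Measure.eqOn_open_of_ae_eq h2 isOpen_Ioi (hf.mono Ioi_subset_Ici_self)
      (hg.mono Ioi_subset_Ici_self)
  exact h1.of_subset_closure hf hg Ioi_subset_Ici_self (by rw [closure_Ioi])

/-! ### Square integrable paths -/

/-- `f` is the continuous representative of `ι ∘ u`, with derivative `v`, for square integrable
`u : [0, ∞) → H₁` and `v : [0, ∞) → H₀`. -/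
structure IsTrajectory (ι : H₁ →L[ℝ] H₀) (u : ℝ → H₁) (v f : ℝ → H₀) : Prop where
  memLp_path : MemLp u 2 halfLine
  memLp_deriv : MemLp v 2 halfLine
  ae_eq : f =ᵐ[halfLine] fun s => ι (u s)
  eq_primitive : ∀ s, 0 ≤ s → f s = f 0 + ∫ t in (0 : ℝ)..s, v t

theorem IsTrajectory.continuousOn {ι : H₁ →L[ℝ] H₀} {u : ℝ → H₁} {v f : ℝ → H₀}
    (h : IsTrajectory ι u v f) : ContinuousOn f (Ici 0) :=
  (continuousOn_const.add (continuousOn_primitive_halfLine h.memLp_deriv)).congr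
    fun s hs => h.eq_primitive s hs

theorem IsTrajectory.memLp {ι : H₁ →L[ℝ] H₀} {u : ℝ → H₁} {v f : ℝ → H₀}
    (h : IsTrajectory ι u v f) : MemLp f 2 halfLine :=
  (memLp_congr_ae h.ae_eq).2 (ι.comp_memLp' h.memLp_path)

/-- The boundary term for a component of a path. -/
theorem IsTrajectory.integral_component {ι : H₁ →L[ℝ] H₀} {u : ℝ → H₁} {v f : ℝ → H₀}
    (h : IsTrajectory ι u v f) (l : H₀ →L[ℝ] ℝ) :
    Integrable (fun s => l (f s) * l (v s)) halfLine ∧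
      2 * ∫ s in Ici (0 : ℝ), l (f s) * l (v s) = -(l (f 0)) ^ 2 := by
  refine integral_mul_deriv_halfLine (u := fun s => l (f s)) (g := fun s => l (v s))
    (l.comp_memLp' h.memLp) (l.comp_memLp' h.memLp_deriv) fun s hs => ?_
  rw [h.eq_primitive s hs, map_add, ← ContinuousLinearMap.intervalIntegral_comp_comm]
  exact MemLp.intervalIntegrable_halfLine h.memLp_deriv le_rfl hs

/-! ### Weighted bases -/

/-- A Riesz basis of `H₀` consisting of vectors in `H₁` that becomes a Riesz basis of `H₁` after
division by weights. -/
structure WeightedBasis (ι : H₁ →L[ℝ] H₀) (I : Type*) where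
  /-- the coordinate functionals -/
  coord : I → H₀ →L[ℝ] ℝ
  /-- the basis vectors -/
  vec : I → H₁
  /-- the weights -/
  w : I → ℝ
  /-- a bound for all the constants -/
  K : ℝ
  w_pos : ∀ i, 0 < w i
  K_pos : 0 < K
  coord_self : ∀ i, coord i (ι (vec i)) = 1
  coord_ne : ∀ i j, i ≠ j → coord i (ι (vec j)) = 0
  hasSum : ∀ x, HasSum (fun i => coord i x • ι (vec i)) x
  bessel_zero : ∀ x (F : Finset I), ∑ i ∈ F, coord i x ^ 2 ≤ K * ‖x‖ ^ 2
  synthesis_zero : ∀ (c : I → ℝ) (F : Finset I),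
    ‖∑ i ∈ F, c i • ι (vec i)‖ ^ 2 ≤ K * ∑ i ∈ F, c i ^ 2
  bessel_one : ∀ y (F : Finset I), ∑ i ∈ F, (w i * coord i (ι y)) ^ 2 ≤ K * ‖y‖ ^ 2
  synthesis_one : ∀ (c : I → ℝ) (F : Finset I),
    ‖∑ i ∈ F, c i • vec i‖ ^ 2 ≤ K * ∑ i ∈ F, (w i * c i) ^ 2

namespace WeightedBasis

variable {ι : H₁ →L[ℝ] H₀} {I J : Type*}

theorem coord_sum (D : WeightedBasis ι I) (c : I → ℝ) (F : Finset I) (i : I) :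
    D.coord i (∑ j ∈ F, c j • ι (D.vec j)) = (F : Set I).indicator c i := by
  classical
  rw [map_sum]
  by_cases hi : i ∈ F
  · rw [indicator_of_mem (by exact_mod_cast hi), Finset.sum_eq_single i]
    · simp [D.coord_self]
    · intro j _ hj
      simp [D.coord_ne i j hj.symm]
    · exact fun h => (h hi).elim
  · rw [indicator_of_notMem (by exact_mod_cast hi)]
    refine Finset.sum_eq_zero fun j hj => ?_
    simp [D.coord_ne i j (fun h => hi (h ▸ hj))]

theorem eq_zero_of_coord (D : WeightedBasis ι I) {x : H₀} (h : ∀ i, D.coord i x = 0) : x = 0 := by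
  have h1 := D.hasSum x
  simp only [h, zero_smul] at h1
  exact h1.unique hasSum_zero

/-- The square of the norm of the interpolation space defined by a weighted basis. -/
def energy (D : WeightedBasis ι I) (x : H₀) : ℝ≥0∞ :=
  ∑' i, ENNReal.ofReal (D.w i * D.coord i x ^ 2)

theorem energy_le_of_sum_le (D : WeightedBasis ι I) {x : H₀} {M : ℝ}
    (h : ∀ F : Finset I, ∑ i ∈ F, D.w i * D.coord i x ^ 2 ≤ M) :
    D.energy x ≤ ENNReal.ofReal M := by
  rw [energy, ENNReal.tsum_eq_iSup_sum]
  refine iSup_le fun F => ?_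
  rw [← ENNReal.ofReal_sum_of_nonneg fun i _ => mul_nonneg (D.w_pos i).le (sq_nonneg _)]
  exact ENNReal.ofReal_le_ofReal (h F)

theorem sum_le_of_energy_ne_top (D : WeightedBasis ι I) {x : H₀} (hx : D.energy x ≠ ⊤)
    (F : Finset I) : ∑ i ∈ F, D.w i * D.coord i x ^ 2 ≤ (D.energy x).toReal := by
  rw [← ENNReal.ofReal_le_iff_le_toReal hx,
    ENNReal.ofReal_sum_of_nonneg fun i _ => mul_nonneg (D.w_pos i).le (sq_nonneg _)]
  exact ENNReal.sum_le_tsum F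

/-- The trace at zero of a path lies in the interpolation space. -/
theorem sum_trace_le (D : WeightedBasis ι I) {u : ℝ → H₁} {v f : ℝ → H₀}
    (h : IsTrajectory ι u v f) (F : Finset I) :
    ∑ i ∈ F, D.w i * D.coord i (f 0) ^ 2 ≤
      D.K * ((∫ s in Ici (0 : ℝ), ‖u s‖ ^ 2) + ∫ s in Ici (0 : ℝ), ‖v s‖ ^ 2) := by
  have hu : Integrable (fun s => ‖u s‖ ^ 2) halfLine := h.memLp_path.integrable_norm_pow (by simp)
  have hv : Integrable (fun s => ‖v s‖ ^ 2) halfLine := h.memLp_deriv.integrable_norm_pow (by simp)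
  have hf : ∀ i, Integrable (fun s => (D.w i * D.coord i (f s)) ^ 2 + D.coord i (v s) ^ 2)
      halfLine := fun i =>
    ((((D.coord i).comp_memLp' h.memLp).const_mul (D.w i)).integrable_sq).add
      ((D.coord i).comp_memLp' h.memLp_deriv).integrable_sq
  -- With `x` the coordinate, `w x(0)² = -2 ∫ w x x' ≤ ∫ ((w x)² + (x')²)`. The first square is
  -- summed by the Bessel inequality in `H₁`, the second by the one in `H₀`.
  have h1 : ∀ i, D.w i * D.coord i (f 0) ^ 2 ≤
      ∫ s in Ici (0 : ℝ), ((D.w i * D.coord i (f s)) ^ 2 + D.coord i (v s) ^ 2) := by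
    intro i
    obtain ⟨hi, he⟩ := h.integral_component (D.coord i)
    have : D.w i * D.coord i (f 0) ^ 2 =
        ∫ s in Ici (0 : ℝ), (-(2 * D.w i)) * (D.coord i (f s) * D.coord i (v s)) := by
      rw [integral_const_mul]
      linear_combination (D.w i) * he
    rw [this]
    refine integral_mono (hi.const_mul _) (hf i) fun s => ?_
    have := sq_nonneg (D.w i * D.coord i (f s) + D.coord i (v s))
    change (-(2 * D.w i)) * (D.coord i (f s) * D.coord i (v s)) ≤
      (D.w i * D.coord i (f s)) ^ 2 + D.coord i (v s) ^ 2
    nlinarith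
  calc ∑ i ∈ F, D.w i * D.coord i (f 0) ^ 2
      ≤ ∑ i ∈ F, ∫ s in Ici (0 : ℝ), ((D.w i * D.coord i (f s)) ^ 2 + D.coord i (v s) ^ 2) :=
        Finset.sum_le_sum fun i _ => h1 i
    _ = ∫ s in Ici (0 : ℝ), ∑ i ∈ F, ((D.w i * D.coord i (f s)) ^ 2 + D.coord i (v s) ^ 2) :=
        (integral_finsetSum F fun i _ => hf i).symm
    _ ≤ ∫ s in Ici (0 : ℝ), D.K * (‖u s‖ ^ 2 + ‖v s‖ ^ 2) := by
        refine integral_mono_ae (integrable_finsetSum F fun i _ => hf i)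
          ((hu.add hv).const_mul _) ?_
        filter_upwards [h.ae_eq] with s hs
        rw [Finset.sum_add_distrib, mul_add, hs]
        exact add_le_add (D.bessel_one _ F) (D.bessel_zero _ F)
    _ = _ := by rw [integral_const_mul, integral_add hu hv]

/-! ### Exponential paths and the comparison of weighted bases -/

theorem memLp_exp_sum (D : WeightedBasis ι I) {E : Type*} [NormedAddCommGroup E]
    [NormedSpace ℝ E] (d : I → ℝ) (x : I → E) (F : Finset I) :
    MemLp (fun s => ∑ i ∈ F, (Real.exp (-D.w i * s) * d i) • x i) 2 halfLine := by
  have hexp : ∀ i, MemLp (fun s => Real.exp (-D.w i * s)) 2 halfLine := by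
    intro i
    rw [memLp_two_iff_integrable_sq (by fun_prop)]
    have h2 : (fun s => Real.exp (-D.w i * s) ^ 2) = fun s => Real.exp (-(2 * D.w i) * s) := by
      ext s
      rw [← Real.exp_nat_mul]
      congr 1
      push_cast
      ring
    rw [h2, halfLine, ← IntegrableOn, integrableOn_Ici_iff_integrableOn_Ioi]
    exact exp_neg_integrableOn_Ioi 0 (by have := D.w_pos i; positivity)
  refine memLp_finsetSum F fun i _ => ?_
  exact (ContinuousLinearMap.toSpanSingleton ℝ (x i)).comp_memLp' ((hexp i).mul_const (d i))

/-- The path `s ↦ exp (-s B) x`, for a finite linear combination `x` of basis vectors and the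
operator `B` that multiplies the basis vectors with the weights. -/
theorem isTrajectory_exp (D : WeightedBasis ι I) (c : I → ℝ) (F : Finset I) :
    IsTrajectory ι (fun s => ∑ i ∈ F, (Real.exp (-D.w i * s) * c i) • D.vec i)
      (fun s => ∑ i ∈ F, (Real.exp (-D.w i * s) * (-D.w i * c i)) • ι (D.vec i))
      (fun s => ∑ i ∈ F, (Real.exp (-D.w i * s) * c i) • ι (D.vec i)) := by
  refine ⟨D.memLp_exp_sum _ _ F, D.memLp_exp_sum _ _ F, Eventually.of_forall fun s => by simp [map_sum], fun s _ => ?_⟩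
  rw [intervalIntegral.integral_eq_sub_of_hasDerivAt
    (f := fun s => ∑ i ∈ F, (Real.exp (-D.w i * s) * c i) • ι (D.vec i))]
  · abel
  · intro t _
    refine HasDerivAt.fun_sum fun i _ => HasDerivAt.smul_const ?_ _
    have h1 : HasDerivAt (fun t : ℝ => -D.w i * t) (-D.w i) t := by
      simpa using (hasDerivAt_id t).const_mul (-D.w i)
    have := h1.exp.mul_const (c i)
    rwa [mul_assoc] at this
  · apply Continuous.intervalIntegrable
    fun_prop

theorem integral_exp_sq {a : ℝ} (ha : 0 < a) (d : ℝ) :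
    Integrable (fun s => (Real.exp (-a * s) * d) ^ 2) halfLine ∧
      ∫ s in Ici (0 : ℝ), (Real.exp (-a * s) * d) ^ 2 = d ^ 2 / (2 * a) := by
  have h2 : (fun s => (Real.exp (-a * s) * d) ^ 2) = fun s => Real.exp (-(2 * a) * s) * d ^ 2 := by
    ext s
    rw [mul_pow, ← Real.exp_nat_mul]
    congr 2
    push_cast
    ring
  rw [h2]
  constructor
  · rw [halfLine, ← IntegrableOn, integrableOn_Ici_iff_integrableOn_Ioi]
    exact (exp_neg_integrableOn_Ioi 0 (by positivity)).mul_const _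
  · rw [integral_mul_const, integral_Ici_eq_integral_Ioi, integral_exp_mul_Ioi (by linarith)]
    simp only [mul_zero, Real.exp_zero]
    field_simp

/-- Weighted bases of the same pair define equivalent norms: the case of finite sums. -/
theorem sum_le_of_finite (D : WeightedBasis ι I) (D' : WeightedBasis ι J) (c : I → ℝ)
    (F : Finset I) (G : Finset J) :
    ∑ j ∈ G, D'.w j * D'.coord j (∑ i ∈ F, c i • ι (D.vec i)) ^ 2 ≤
      D'.K * D.K * ∑ i ∈ F, D.w i * c i ^ 2 := by
  -- The trace method: the vector is the value at zero of an exponential path built from `D`, and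
  -- the trace bound for `D'` is applied to that path. Both terms of its `P₁` norm reduce to `∫
  -- (exp(-w s) w c)² = w c² / 2`.
  have hT := D.isTrajectory_exp c F
  have h := D'.sum_trace_le hT G
  simp only [mul_zero, Real.exp_zero, one_mul] at h
  refine h.trans ?_
  rw [mul_assoc]
  refine mul_le_mul_of_nonneg_left ?_ D'.K_pos.le
  have hu : Integrable (fun s => ‖∑ i ∈ F, (Real.exp (-D.w i * s) * c i) • D.vec i‖ ^ 2)
      halfLine := hT.memLp_path.integrable_norm_pow (by simp)
  have hv : Integrable (fun s =>
      ‖∑ i ∈ F, (Real.exp (-D.w i * s) * (-D.w i * c i)) • ι (D.vec i)‖ ^ 2)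
      halfLine := hT.memLp_deriv.integrable_norm_pow (by simp)
  have hi : ∀ i, Integrable (fun s => (Real.exp (-D.w i * s) * (D.w i * c i)) ^ 2) halfLine :=
    fun i => (integral_exp_sq (D.w_pos i) _).1
  have hsum : ∫ s in Ici (0 : ℝ), D.K * ∑ i ∈ F, (Real.exp (-D.w i * s) * (D.w i * c i)) ^ 2
      = D.K * ∑ i ∈ F, D.w i * c i ^ 2 / 2 := by
    rw [integral_const_mul, integral_finsetSum F fun i _ => hi i]
    congr 1
    refine Finset.sum_congr rfl fun i _ => ?_
    rw [(integral_exp_sq (D.w_pos i) _).2]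
    have := (D.w_pos i).ne'
    field_simp
  have hI : Integrable (fun s => D.K * ∑ i ∈ F, (Real.exp (-D.w i * s) * (D.w i * c i)) ^ 2)
      halfLine := (integrable_finsetSum F fun i _ => hi i).const_mul _
  have e1 : ∫ s in Ici (0 : ℝ), ‖∑ i ∈ F, (Real.exp (-D.w i * s) * c i) • D.vec i‖ ^ 2 ≤
      D.K * ∑ i ∈ F, D.w i * c i ^ 2 / 2 := by
    rw [← hsum]
    refine integral_mono hu hI fun s => ?_
    refine (D.synthesis_one _ F).trans (le_of_eq ?_)
    congr 1
    exact Finset.sum_congr rfl fun i _ => by ring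
  have e2 : ∫ s in Ici (0 : ℝ),
      ‖∑ i ∈ F, (Real.exp (-D.w i * s) * (-D.w i * c i)) • ι (D.vec i)‖ ^ 2 ≤
      D.K * ∑ i ∈ F, D.w i * c i ^ 2 / 2 := by
    rw [← hsum]
    refine integral_mono hv hI fun s => ?_
    refine (D.synthesis_zero _ F).trans (le_of_eq ?_)
    congr 1
    exact Finset.sum_congr rfl fun i _ => by ring
  refine (add_le_add e1 e2).trans (le_of_eq ?_)
  rw [← mul_add, ← Finset.sum_add_distrib]
  congr 1
  exact Finset.sum_congr rfl fun i _ => by ring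

/-- Weighted bases of the same pair define equivalent norms. -/
theorem energy_le (D : WeightedBasis ι I) (D' : WeightedBasis ι J) (x : H₀) :
    D'.energy x ≤ ENNReal.ofReal (D'.K * D.K) * D.energy x := by
  have hK : 0 < D'.K * D.K := mul_pos D'.K_pos D.K_pos
  by_cases hx : D.energy x = ⊤
  · rw [hx, ENNReal.mul_top (by simpa using hK)]
    exact le_top
  rw [← ENNReal.ofReal_toReal hx, ← ENNReal.ofReal_mul hK.le]
  refine D'.energy_le_of_sum_le fun G => ?_
  -- Partial sums converge only in `H₀`, which suffices: `G` is finite and each coordinate of `D'`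
  -- is continuous on `H₀`.
  have hlim : Tendsto (fun F : Finset I => ∑ j ∈ G, D'.w j *
      D'.coord j (∑ i ∈ F, D.coord i x • ι (D.vec i)) ^ 2) atTop
      (𝓝 (∑ j ∈ G, D'.w j * D'.coord j x ^ 2)) :=
    tendsto_finsetSum G fun j _ =>
      ((((D'.coord j).continuous.tendsto x).comp (D.hasSum x)).pow 2).const_mul _
  refine le_of_tendsto' hlim fun F => (D.sum_le_of_finite D' _ F G).trans ?_
  exact mul_le_mul_of_nonneg_left (D.sum_le_of_energy_ne_top hx F) hK.le

end WeightedBasis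

/-! ### The weighted basis of the growth operator -/

/-- A Hilbert basis adapted to a complete family of mutually orthogonal closed subspaces. -/
theorem exists_adapted_hilbertBasis {E : Type u} [NormedAddCommGroup E] [InnerProductSpace ℝ E]
    [CompleteSpace E] {k : Type*} (V : k → Submodule ℝ E) [∀ i, CompleteSpace (V i)]
    (horth : Pairwise fun i j => V i ⟂ V j)
    (htotal : ∀ x, (∀ i, (V i).starProjection x = 0) → x = 0) :
    ∃ (J : k → Type u) (B : HilbertBasis (Σ i, J i) ℝ E), (∀ a, B a ∈ V a.1) ∧
      ∀ i x, HasSum (fun j : J i => inner ℝ (B ⟨i, j⟩) x ^ 2) (‖(V i).starProjection x‖ ^ 2) := by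
  choose J b hb using fun i => exists_hilbertBasis ℝ (V i)
  have hV : OrthogonalFamily ℝ (fun i => V i) fun i => (V i).subtypeₗᵢ :=
    OrthogonalFamily.of_pairwise horth
  have hon : Orthonormal ℝ fun a : Σ i, J i => ((b a.1 a.2 : V a.1) : E) :=
    hV.orthonormal_sigma_orthonormal fun i => (b i).orthonormal
  have hpars : ∀ i x, HasSum (fun j : J i => inner ℝ ((b i j : V i) : E) x ^ 2)
      (‖(V i).starProjection x‖ ^ 2) := by
    intro i x
    have h := (b i).hasSum_inner_mul_inner ((V i).orthogonalProjectionOnto x)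
      ((V i).orthogonalProjectionOnto x)
    rw [real_inner_self_eq_norm_sq] at h
    have hin : ∀ j : J i, inner ℝ (b i j) ((V i).orthogonalProjectionOnto x) =
        inner ℝ ((b i j : V i) : E) x := fun j =>
      Submodule.inner_orthogonalProjectionOnto_eq_of_mem_left _ _
    rw [Submodule.starProjection_apply]
    simp only [real_inner_comm (b i _), hin, ← sq] at h
    exact h
  have hbot : (Submodule.span ℝ (range fun a : Σ i, J i => ((b a.1 a.2 : V a.1) : E)))ᗮ = ⊥ := by
    rw [Submodule.eq_bot_iff]
    intro x hx
    -- By Parseval in `V i`, a vector orthogonal to the chosen basis of `V i` has zero projection to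
    -- `V i`.
    refine htotal x fun i => ?_
    have h := hpars i x
    have h0 : ∀ j : J i, inner ℝ ((b i j : V i) : E) x = 0 := fun j =>
      hx _ (Submodule.subset_span ⟨⟨i, j⟩, rfl⟩)
    simp only [h0, ne_eq, OfNat.ofNat_ne_zero, not_false_eq_true, zero_pow] at h
    simpa using h.unique hasSum_zero
  refine ⟨fun i => ↥(J i), HilbertBasis.mkOfOrthogonalEqBot hon hbot, fun a => ?_, fun i x => ?_⟩
  · rw [HilbertBasis.coe_mkOfOrthogonalEqBot]
    exact (b a.1 a.2).2
  · rw [HilbertBasis.coe_mkOfOrthogonalEqBot]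
    exact hpars i x

theorem norm_sq_sum_orthonormal {E : Type*} [NormedAddCommGroup E] [InnerProductSpace ℝ E]
    {I : Type*} {b : I → E} (hb : Orthonormal ℝ b) (c : I → ℝ) (F : Finset I) :
    ‖∑ i ∈ F, c i • b i‖ ^ 2 = ∑ i ∈ F, c i ^ 2 := by
  rw [← real_inner_self_eq_norm_sq, hb.inner_sum]
  exact Finset.sum_congr rfl fun i _ => by simp [sq]

theorem GrowthEigenvalues.pos (ι : H₁ →L[ℝ] H₀) [HilbertPair ι] (κ : GrowthEigenvalues ι) :
    0 < (κ : ℝ) := by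
  obtain ⟨v, hv⟩ := Module.End.HasEigenvalue.exists_hasEigenvector
    (show Module.End.HasEigenvalue (growthOp ι : Module.End ℝ H₁) κ from κ.property)
  have e : growthOp ι v = (κ : ℝ) • v := hv.apply_eq_smul
  have h1 := inner_growthOp ι v v
  rw [e, real_inner_smul_right, real_inner_self_eq_norm_sq, real_inner_self_eq_norm_sq] at h1
  have h2 : 0 < ‖v‖ ^ 2 := by have := norm_pos_iff.mpr hv.2; positivity
  have h3 : 0 < ‖ι v‖ ^ 2 := by
    have : ι v ≠ 0 := fun h => hv.2 (HilbertPair.injective (ι := ι) (by simpa using h))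
    have := norm_pos_iff.mpr this
    positivity
  rw [h1] at h3
  exact pos_of_mul_pos_left h3 h2.le

/-- Applying `ι` to the eigenvalue equation of `ι* ι` on `H₁` gives one for `ι ι*` on `H₀`. It is a
closed condition, so it survives the closure in `coreEigenspace`. -/
theorem adjoint_of_mem_coreEigenspace (ι : H₁ →L[ℝ] H₀) {κ : ℝ} {x : H₀}
    (hx : x ∈ coreEigenspace ι κ) : ι (ι.adjoint x) = κ • x := by
  have hcl : IsClosed {x : H₀ | ι (ι.adjoint x) = κ • x} :=
    isClosed_eq (by fun_prop) (by fun_prop)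
  refine closure_minimal ?_ hcl hx
  rintro _ ⟨y, hy, rfl⟩
  have hy' : ι.adjoint (ι y) = κ • y := Module.End.mem_eigenspace_iff.1 hy
  change ι (ι.adjoint (ι y)) = κ • ι y
  rw [hy', map_smul]

/-- An orthonormal eigenbasis `B` of `ι ι*` in `H₀`, with weights `κ^{-1/2}`. Since `⟨ι* B a, ι* B
a'⟩ = ⟨B a, ι ι* B a'⟩`, the vectors `κ^{-1/2} ι* B a` are orthonormal in `H₁`, so all Riesz
constants equal `1`. Grouping the energy by eigenvalue recovers the series that defines `H_{1/2}`,
which makes this the reference for all other bases. -/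
theorem exists_growthBasis {H₀ : Type u} {H₁ : Type v}
    [NormedAddCommGroup H₀] [InnerProductSpace ℝ H₀] [CompleteSpace H₀]
    [NormedAddCommGroup H₁] [InnerProductSpace ℝ H₁] [CompleteSpace H₁]
    (ι : H₁ →L[ℝ] H₀) [HilbertPair ι] :
    ∃ (I : Type u) (D : WeightedBasis ι I), ∀ x,
      D.energy x = ∑' κ : GrowthEigenvalues ι, ENNReal.ofReal (‖weighted ι x κ‖ ^ 2) := by
  classical
  have horth : Pairwise fun κ κ' : GrowthEigenvalues ι =>
      coreEigenspace ι κ ⟂ coreEigenspace ι κ' := by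
    intro κ κ' hne
    rw [Submodule.isOrtho_iff_inner_eq]
    intro x hx y hy
    have h1 := adjoint_of_mem_coreEigenspace ι hx
    have h2 := adjoint_of_mem_coreEigenspace ι hy
    have h3 : inner ℝ (ι (ι.adjoint x)) y = inner ℝ x (ι (ι.adjoint y)) := by
      rw [← ContinuousLinearMap.adjoint_inner_right, ContinuousLinearMap.adjoint_inner_left]
    rw [h1, h2, real_inner_smul_left, real_inner_smul_right] at h3
    have h4 : ((κ : ℝ) - κ') * inner ℝ x y = 0 := by linarith
    exact (mul_eq_zero.1 h4).resolve_left fun h => hne (Subtype.ext (sub_eq_zero.1 h))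
  obtain ⟨J, B, hB, hpars⟩ := exists_adapted_hilbertBasis
    (fun κ : GrowthEigenvalues ι => coreEigenspace ι κ) horth
    fun x hx => eq_zero_of_component_eq_zero ι x hx
  have hpos : ∀ a : Σ κ, J κ, 0 < (a.1 : ℝ) := fun a => GrowthEigenvalues.pos ι a.1
  set w : (Σ κ, J κ) → ℝ := fun a => (a.1 : ℝ) ^ (-(1 / 2) : ℝ)
  have hw : ∀ a, 0 < w a := fun a => Real.rpow_pos_of_pos (hpos a) _
  have hw2 : ∀ a, w a * w a = (a.1 : ℝ)⁻¹ := fun a => by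
    simp only [w]
    rw [← Real.rpow_add (hpos a), ← Real.rpow_neg_one]
    norm_num
  set g : (Σ κ, J κ) → H₁ := fun a => w a • ι.adjoint (B a)
  have hg : Orthonormal ℝ g := by
    rw [orthonormal_iff_ite]
    intro a a'
    have h1 := (orthonormal_iff_ite.1 B.orthonormal) a a'
    simp only [g]
    rw [real_inner_smul_left, real_inner_smul_right, ContinuousLinearMap.adjoint_inner_left,
      adjoint_of_mem_coreEigenspace ι (hB a'), real_inner_smul_right, h1]
    split_ifs with h
    · subst h
      rw [mul_one, ← mul_assoc, hw2, inv_mul_cancel₀ (hpos a).ne']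
    · simp
  have hvec : ∀ a, ι ((a.1 : ℝ)⁻¹ • ι.adjoint (B a)) = B a := fun a => by
    rw [map_smul, adjoint_of_mem_coreEigenspace ι (hB a), smul_smul,
      inv_mul_cancel₀ (hpos a).ne', one_smul]
  have hon := orthonormal_iff_ite.1 B.orthonormal
  let D : WeightedBasis ι (Σ κ, J κ) :=
    { coord := fun a => innerSL ℝ (B a)
      vec := fun a => (a.1 : ℝ)⁻¹ • ι.adjoint (B a)
      w := w
      K := 1
      w_pos := hw
      K_pos := one_pos
      coord_self := fun a => by rw [hvec, innerSL_apply_apply, hon, if_pos rfl]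
      coord_ne := fun a a' h => by rw [hvec, innerSL_apply_apply, hon, if_neg h]
      hasSum := fun x => by
        have h := B.hasSum_repr x
        simpa only [hvec, innerSL_apply_apply, ← B.repr_apply_apply] using h
      bessel_zero := fun x F => by
        have h := B.orthonormal.sum_inner_products_le x (s := F)
        simpa using h
      synthesis_zero := fun c F => by
        simp only [hvec, one_mul]
        exact (norm_sq_sum_orthonormal B.orthonormal c F).le
      bessel_one := fun y F => by
        have h := hg.sum_inner_products_le y (s := F)
        refine le_trans (le_of_eq (Finset.sum_congr rfl fun a _ => ?_)) (h.trans (one_mul _).ge)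
        simp only [g, Real.norm_eq_abs, sq_abs, real_inner_smul_left, innerSL_apply_apply,
          ContinuousLinearMap.adjoint_inner_left]
      synthesis_one := fun c F => by
        rw [one_mul, ← norm_sq_sum_orthonormal hg]
        refine le_of_eq ?_
        congr 2
        refine Finset.sum_congr rfl fun a _ => ?_
        simp only [g, smul_smul]
        congr 1
        rw [← hw2]
        ring }
  refine ⟨_, D, fun x => ?_⟩
  rw [WeightedBasis.energy, ENNReal.tsum_sigma']
  refine tsum_congr fun κ => ?_
  have h1 : ‖weighted ι x κ‖ ^ 2 = (κ : ℝ) ^ (-(1 / 2) : ℝ) * ‖component ι κ x‖ ^ 2 := by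
    have hκ := GrowthEigenvalues.pos ι κ
    rw [weighted, norm_smul, mul_pow, Real.norm_eq_abs, sq_abs, ← Real.rpow_natCast,
      ← Real.rpow_mul hκ.le]
    norm_num
  have h2 := (hpars κ x).mul_left ((κ : ℝ) ^ (-(1 / 2) : ℝ))
  rw [h1, component, ← h2.tsum_eq, ENNReal.ofReal_tsum_of_nonneg _ h2.summable]
  · rfl
  · intro j
    have := Real.rpow_pos_of_pos (GrowthEigenvalues.pos ι κ) (-(1 / 2) : ℝ)
    positivity

theorem mem_halfSubmodule_iff (ι : H₁ →L[ℝ] H₀) (x : H₀) :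
    x ∈ halfSubmodule ι ↔
      ∑' κ : GrowthEigenvalues ι, ENNReal.ofReal (‖weighted ι x κ‖ ^ 2) ≠ ⊤ := by
  have h : x ∈ halfSubmodule ι ↔ Summable fun κ => ‖weighted ι x κ‖ ^ 2 := by
    change Memℓp (weighted ι x) 2 ↔ _
    rw [memℓp_gen_iff (by norm_num)]
    simp
  rw [h]
  refine ⟨fun h => h.tsum_ofReal_ne_top, fun h => ?_⟩
  have := ENNReal.summable_toReal h
  simpa [ENNReal.toReal_ofReal] using this

theorem HHalf.ofReal_norm_sq (ι : H₁ →L[ℝ] H₀) [HilbertPair ι] (x : HHalf ι) :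
    ENNReal.ofReal (‖x‖ ^ 2) =
      ∑' κ : GrowthEigenvalues ι, ENNReal.ofReal (‖weighted ι (HHalf.incl ι x) κ‖ ^ 2) := by
  have hm := x.2
  have hs : Summable fun κ => ‖weighted ι (HHalf.incl ι x) κ‖ ^ 2 := by
    have : Memℓp (weighted ι (HHalf.incl ι x)) 2 := hm
    rw [memℓp_gen_iff (by norm_num)] at this
    simpa using this
  rw [← ENNReal.ofReal_tsum_of_nonneg (fun _ => by positivity) hs, HHalf.norm_sq]
  congr 1
  refine tsum_congr fun κ => ?_
  rw [weighted, norm_smul, mul_pow, Real.norm_eq_abs, sq_abs]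

/-- Any weighted basis describes the space `H_{1/2}`. -/
theorem WeightedBasis.mem_halfSubmodule {ι : H₁ →L[ℝ] H₀} [HilbertPair ι] {I : Type*}
    (D : WeightedBasis ι I) {x : H₀} : x ∈ halfSubmodule ι ↔ D.energy x ≠ ⊤ := by
  obtain ⟨J, G, hG⟩ := exists_growthBasis ι
  rw [mem_halfSubmodule_iff, ← hG]
  constructor
  · intro h
    exact ne_top_of_le_ne_top (ENNReal.mul_ne_top ENNReal.ofReal_ne_top h) (G.energy_le D x)
  · intro h
    exact ne_top_of_le_ne_top (ENNReal.mul_ne_top ENNReal.ofReal_ne_top h) (D.energy_le G x)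

/-- Any weighted basis describes the norm of `H_{1/2}` up to equivalence. -/
theorem WeightedBasis.exists_norm_equiv {ι : H₁ →L[ℝ] H₀} [HilbertPair ι] {I : Type*}
    (D : WeightedBasis ι I) : ∃ C : ℝ, 0 < C ∧ ∀ x : HHalf ι,
      ‖x‖ ^ 2 ≤ C * (D.energy (HHalf.incl ι x)).toReal ∧
      (D.energy (HHalf.incl ι x)).toReal ≤ C * ‖x‖ ^ 2 := by
  obtain ⟨J, G, hG⟩ := exists_growthBasis ι
  have hC : 0 < G.K * D.K := mul_pos G.K_pos D.K_pos
  refine ⟨G.K * D.K, hC, fun x => ?_⟩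
  have hx : D.energy (HHalf.incl ι x) ≠ ⊤ := D.mem_halfSubmodule.1 x.2
  constructor
  · rw [← ENNReal.ofReal_le_ofReal_iff (by positivity), ENNReal.ofReal_mul hC.le,
      ENNReal.ofReal_toReal hx, HHalf.ofReal_norm_sq, ← hG]
    exact D.energy_le G _
  · rw [← ENNReal.ofReal_le_ofReal_iff (by positivity), ENNReal.ofReal_mul hC.le,
      ENNReal.ofReal_toReal hx, HHalf.ofReal_norm_sq, ← hG, mul_comm G.K]
    exact G.energy_le D _

/-! ### The spectral basis of an invertible symmetrizable operator -/

/-- A copy of `H₀`, to carry another inner product. -/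
def InnerModel (H₀ : Type*) : Type _ := H₀

instance : AddCommGroup (InnerModel H₀) := inferInstanceAs (AddCommGroup H₀)

instance : Module ℝ (InnerModel H₀) := inferInstanceAs (Module ℝ H₀)

/-- An equivalent inner product is realized by an isomorphism with a Hilbert space. -/
theorem exists_innerModel {H₀ : Type u} [NormedAddCommGroup H₀] [InnerProductSpace ℝ H₀]
    [CompleteSpace H₀] (p : InnerProductSpace.Core ℝ H₀) (hp : IsEquivalentInner p) :
    ∃ (E : Type u) (_ : NormedAddCommGroup E) (_ : InnerProductSpace ℝ E) (_ : CompleteSpace E)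
      (Ψ : H₀ ≃L[ℝ] E), ∀ x y, inner ℝ (Ψ x) (Ψ y) = p.inner x y := by
  let p' : InnerProductSpace.Core ℝ (InnerModel H₀) := p
  let i1 : NormedAddCommGroup (InnerModel H₀) :=
    @InnerProductSpace.Core.toNormedAddCommGroup ℝ _ _ _ _ p'
  let i2 : InnerProductSpace ℝ (InnerModel H₀) := InnerProductSpace.ofCore p'.toCore
  obtain ⟨c, hc, hb⟩ := hp
  let L : H₀ ≃ₗ[ℝ] InnerModel H₀ :=
    { toFun := fun x => x
      invFun := fun x => x
      map_add' := fun _ _ => rfl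
      map_smul' := fun _ _ => rfl
      left_inv := fun _ => rfl
      right_inv := fun _ => rfl }
  have hn : ∀ x : H₀, ‖L x‖ = √(p.inner x x) := fun x =>
    norm_eq_sqrt_real_inner (L x)
  let Ψ : H₀ ≃L[ℝ] InnerModel H₀ := L.toContinuousLinearEquivOfBounds c c
    (fun x => by rw [hn]; exact (hb x).2)
    (fun x => by
      have h := (hb (L.symm x)).1
      rw [← hn, LinearEquiv.apply_symm_apply, one_div, inv_mul_le_iff₀ hc] at h
      exact h)
  refine ⟨InnerModel H₀, i1, i2, (completeSpace_congr (e := Ψ.toEquiv) Ψ.isUniformEmbedding).1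
    inferInstance, Ψ, fun x y => rfl⟩

/-- A weighted basis of eigenvectors of `A`; the weights are the absolute values of the
eigenvalues. -/
structure SpectralBasis (ι A : H₁ →L[ℝ] H₀) (I : Type*) extends WeightedBasis ι I where
  /-- the eigenvalues -/
  a : I → ℝ
  w_eq : ∀ i, w i = |a i|
  coord_apply : ∀ i y, coord i (A y) = a i * coord i (ι y)

theorem sq_norm_apply_le {X Y : Type*} [NormedAddCommGroup X] [NormedSpace ℝ X]
    [NormedAddCommGroup Y] [NormedSpace ℝ Y] (T : X →L[ℝ] Y) (x : X) :
    ‖T x‖ ^ 2 ≤ ‖T‖ ^ 2 * ‖x‖ ^ 2 := by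
  rw [← mul_pow]
  exact pow_le_pow_left₀ (norm_nonneg _) (T.le_opNorm x) 2

/-- Conjugated to the Hilbert space `E` of the symmetrizing inner product, `ι A⁻¹` becomes a compact
symmetric injective operator `S`. If `S` has eigenvalue `μ`, then `A` has eigenvalue `μ⁻¹`, and
symmetry gives `coord (A y) = μ⁻¹ coord (ι y)`. The weighted coordinates of `y` are thus, up to
sign, orthonormal coefficients of `A y`; the `H₁` bounds follow because `A` and its inverse are
bounded. -/
theorem exists_spectralBasis {H₀ : Type u} {H₁ : Type v}
    [NormedAddCommGroup H₀] [InnerProductSpace ℝ H₀] [CompleteSpace H₀]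
    [NormedAddCommGroup H₁] [InnerProductSpace ℝ H₁] [CompleteSpace H₁]
    {ι A : H₁ →L[ℝ] H₀} [HilbertPair ι] (hs : IsSymmetrizable ι A) (hA : A.IsInvertible) :
    ∃ I : Type u, Nonempty (SpectralBasis ι A I) := by
  classical
  obtain ⟨p, hp, hsym⟩ := hs
  obtain ⟨E, i1, i2, i3, Ψ, hΨ⟩ := exists_innerModel p hp
  obtain ⟨e, rfl⟩ := hA
  let R : E →L[ℝ] H₁ := (e.symm : H₀ →L[ℝ] H₁) ∘L (Ψ.symm : E →L[ℝ] H₀)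
  have hR : ∀ x, Ψ (e (R x)) = x := fun x => by simp [R]
  have hRe : ∀ y, R (Ψ (e y)) = y := fun y => by simp [R]
  let S : E →L[ℝ] E := (Ψ : H₀ →L[ℝ] E) ∘L ι ∘L R
  have hS : ∀ x, S x = Ψ (ι (R x)) := fun x => rfl
  have hcomp : IsCompactOperator S :=
    ((HilbertPair.compact (ι := ι)).comp_clm R).clm_comp (Ψ : H₀ →L[ℝ] E)
  have hSsym : (S : E →ₗ[ℝ] E).IsSymmetric := by
    intro x y
    change inner ℝ (S x) y = inner ℝ x (S y)
    conv_lhs => rw [← hR y]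
    conv_rhs => rw [← hR x]
    rw [hS, hS, hΨ, hΨ]
    exact (hsym (R x) (R y)).symm
  have hSinj : ∀ x, S x = 0 → x = 0 := by
    intro x hx
    have h1 : ι (R x) = 0 := Ψ.injective (by rw [← hS, hx, map_zero])
    have h2 : R x = 0 := HilbertPair.injective (ι := ι) (by rw [h1, map_zero])
    rw [← hR x, h2, map_zero, map_zero]
  have hbot := ContinuousLinearMap.orthogonalComplement_iSup_eigenspaces_eq_bot hcomp hSsym
  obtain ⟨J, B, hB, -⟩ := exists_adapted_hilbertBasis
    (fun μ : ℝ => Module.End.eigenspace (S : Module.End ℝ E) μ)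
    (fun μ μ' hne => by
      beta_reduce
      rw [Submodule.isOrtho_iff_inner_eq]
      intro x hx y hy
      exact hSsym.orthogonalFamily_eigenspaces hne ⟨x, hx⟩ ⟨y, hy⟩)
    (fun x hx => by
      rw [← Submodule.mem_bot ℝ, ← hbot, Submodule.mem_orthogonal]
      intro u hu
      induction hu using Submodule.iSup_induction' with
      | mem μ v hv =>
        have h : x ∈ (Module.End.eigenspace (S : Module.End ℝ E) μ)ᗮ := by
          rw [← Submodule.ker_starProjection]
          exact hx μ
        exact h v hv
      | zero => simp
      | add a b _ _ ha hb => rw [inner_add_left, ha, hb, add_zero])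
  have hSB : ∀ i, S (B i) = i.1 • B i := fun i => Module.End.mem_eigenspace_iff.1 (hB i)
  -- The indices run over all real `μ`, with empty fibre where `μ` is not an eigenvalue. Injectivity
  -- of `S` empties the fibre over zero, so the inverses are meaningful.
  have hμ : ∀ i : Σ μ : ℝ, J μ, i.1 ≠ 0 := by
    intro i h0
    have h := hSB i
    rw [h0, zero_smul] at h
    have h1 := B.orthonormal.1 i
    rw [hSinj _ h, norm_zero] at h1
    exact zero_ne_one h1
  have hvec : ∀ i : Σ μ : ℝ, J μ, ι (i.1⁻¹ • R (B i)) = Ψ.symm (B i) := fun i => by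
    apply Ψ.injective
    rw [map_smul, map_smul, ← hS, hSB, smul_smul, inv_mul_cancel₀ (hμ i), one_smul,
      Ψ.apply_symm_apply]
  have hon := orthonormal_iff_ite.1 B.orthonormal
  have hcoord : ∀ (i : Σ μ : ℝ, J μ) y, inner ℝ (B i) (Ψ (e y)) =
      i.1⁻¹ * inner ℝ (B i) (Ψ (ι y)) := fun i y => by
    have h1 : inner ℝ (S (B i)) (Ψ (e y)) = inner ℝ (B i) (S (Ψ (e y))) := hSsym _ _
    rw [hSB, real_inner_smul_left, hS, hRe] at h1
    rw [← h1, ← mul_assoc, inv_mul_cancel₀ (hμ i), one_mul]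
  set P : H₀ →L[ℝ] E := (Ψ : H₀ →L[ℝ] E)
  set P' : E →L[ℝ] H₀ := (Ψ.symm : E →L[ℝ] H₀)
  set Q : H₁ →L[ℝ] E := P ∘L (e : H₁ →L[ℝ] H₀)
  set K : ℝ := ‖P‖ ^ 2 + ‖P'‖ ^ 2 + ‖Q‖ ^ 2 + ‖R‖ ^ 2 + 1
  have hK : ‖P‖ ^ 2 ≤ K ∧ ‖P'‖ ^ 2 ≤ K ∧ ‖Q‖ ^ 2 ≤ K ∧ ‖R‖ ^ 2 ≤ K ∧ 0 < K := by
    have h1 := sq_nonneg ‖P‖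
    have h2 := sq_nonneg ‖P'‖
    have h3 := sq_nonneg ‖Q‖
    have h4 := sq_nonneg ‖R‖
    simp only [K]
    refine ⟨?_, ?_, ?_, ?_, ?_⟩ <;> linarith
  obtain ⟨hK1, hK2, hK3, hK4, hK0⟩ := hK
  have hbes : ∀ (x : E) (F : Finset (Σ μ : ℝ, J μ)), ∑ i ∈ F, inner ℝ (B i) x ^ 2 ≤ ‖x‖ ^ 2 := by
    intro x F
    simpa using B.orthonormal.sum_inner_products_le x (s := F)
  refine ⟨_, ⟨
    { coord := fun i => innerSL ℝ (B i) ∘L P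
      vec := fun i => i.1⁻¹ • R (B i)
      w := fun i => |i.1⁻¹|
      K := K
      w_pos := fun i => abs_pos.2 (inv_ne_zero (hμ i))
      K_pos := hK0
      coord_self := fun i => by simp [hvec, P, B.orthonormal.1]
      coord_ne := fun i j h => by simp [hvec, P, hon, h]
      hasSum := fun x => by
        have h := (B.hasSum_repr (Ψ x)).mapL P'
        simpa [hvec, P, P', B.repr_apply_apply] using h
      bessel_zero := fun x F => (hbes (P x) F).trans ((sq_norm_apply_le P x).trans (by gcongr))
      synthesis_zero := fun c F => by
        have h := sq_norm_apply_le P' (∑ i ∈ F, c i • B i)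
        rw [norm_sq_sum_orthonormal B.orthonormal, map_sum] at h
        simp only [hvec]
        simp only [map_smul] at h
        have h0 : 0 ≤ ∑ i ∈ F, c i ^ 2 := Finset.sum_nonneg fun i _ => sq_nonneg _
        exact h.trans (by gcongr)
      bessel_one := fun y F => by
        refine le_trans (le_of_eq (Finset.sum_congr rfl fun i _ => ?_))
          ((hbes (Q y) F).trans ((sq_norm_apply_le Q y).trans (by gcongr)))
        change (|i.1⁻¹| * inner ℝ (B i) (Ψ (ι y))) ^ 2 = inner ℝ (B i) (Ψ (e y)) ^ 2
        rw [hcoord, mul_pow, mul_pow, sq_abs]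
      synthesis_one := fun c F => by
        have h := sq_norm_apply_le R (∑ i ∈ F, (c i * i.1⁻¹) • B i)
        rw [norm_sq_sum_orthonormal B.orthonormal, map_sum] at h
        simp only [map_smul] at h
        simp only [smul_smul, mul_pow, sq_abs]
        have h0 : 0 ≤ ∑ i ∈ F, (i.1⁻¹ ^ 2 * c i ^ 2) :=
          Finset.sum_nonneg fun i _ => by positivity
        refine h.trans ((le_of_eq ?_).trans (mul_le_mul_of_nonneg_right hK4 h0))
        congr 1
        exact Finset.sum_congr rfl fun i _ => by ring
      a := fun i => i.1⁻¹
      w_eq := fun i => rfl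
      coord_apply := hcoord }⟩⟩

namespace SpectralBasis

variable {ι A : H₁ →L[ℝ] H₀} {I : Type*}

theorem apply_vec (D : SpectralBasis ι A I) (i : I) : A (D.vec i) = D.a i • ι (D.vec i) := by
  rw [← sub_eq_zero]
  refine D.eq_zero_of_coord fun j => ?_
  rw [map_sub, map_smul, D.coord_apply]
  by_cases h : j = i
  · subst h
    simp
  · simp [D.coord_ne j i h]

theorem a_ne_zero (D : SpectralBasis ι A I) (i : I) : D.a i ≠ 0 := by
  rw [← abs_pos, ← D.w_eq]
  exact D.w_pos i

end SpectralBasis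

/-! ### The space `H_{1/2}` and its spectral subspaces in coordinates -/

namespace WeightedBasis

variable {ι : H₁ →L[ℝ] H₀} {I : Type*}

/-- The coordinate projection to a set of indices. -/
theorem exists_restrict (D : WeightedBasis ι I) (S : Set I) (x : H₀) :
    ∃ y, ∀ i, D.coord i y = S.indicator (fun i => D.coord i x) i := by
  obtain ⟨y, hy⟩ := (D.hasSum x).summable.indicator S
  refine ⟨y, fun i => ?_⟩
  have h1 := hy.mapL (D.coord i)
  refine h1.unique ?_
  have h2 := hasSum_single (f := fun j => D.coord i (S.indicator
    (fun j => D.coord j x • ι (D.vec j)) j)) i fun j hj => by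
      by_cases hjS : j ∈ S
      · simp [hjS, D.coord_ne i j hj.symm]
      · simp [hjS]
  convert h2 using 1
  by_cases hiS : i ∈ S
  · simp [hiS, D.coord_self]
  · simp [hiS]

theorem energy_mono (D : WeightedBasis ι I) {x y : H₀}
    (h : ∀ i, D.coord i y ^ 2 ≤ D.coord i x ^ 2) : D.energy y ≤ D.energy x :=
  ENNReal.tsum_le_tsum fun i => ENNReal.ofReal_le_ofReal
    (mul_le_mul_of_nonneg_left (h i) (D.w_pos i).le)

theorem energy_vec (D : WeightedBasis ι I) (i : I) :
    D.energy (ι (D.vec i)) = ENNReal.ofReal (D.w i) := by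
  rw [energy, tsum_eq_single i fun j hj => by simp [D.coord_ne j i hj]]
  simp [D.coord_self]

/-- The part of the energy outside of a finite set tends to zero. -/
theorem tendsto_energy_sub_sum (D : WeightedBasis ι I) {x : H₀} (hx : D.energy x ≠ ⊤) :
    Tendsto (fun F : Finset I => D.energy (x - ∑ i ∈ F, D.coord i x • ι (D.vec i))) atTop
      (𝓝 0) := by
  refine (ENNReal.tendsto_tsum_compl_atTop_zero hx).congr fun F => ?_
  have h := tsum_subtype {i | i ∉ F} fun i => ENNReal.ofReal (D.w i * D.coord i x ^ 2)
  refine h.trans (tsum_congr fun i => ?_)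
  rw [map_sub, D.coord_sum]
  by_cases hi : i ∈ F
  · simp [hi]
  · simp [hi]

variable [HilbertPair ι]

/-- The coordinates as functionals on `H_{1/2}`. -/
theorem exists_coord_half_bound (D : WeightedBasis ι I) (i : I) :
    ∃ C : ℝ, ∀ x : HHalf ι, |D.coord i (HHalf.incl ι x)| ≤ C * ‖x‖ := by
  obtain ⟨C, hC, hb⟩ := D.exists_norm_equiv
  refine ⟨√(C / D.w i), fun x => ?_⟩
  have h1 : D.w i * D.coord i (HHalf.incl ι x) ^ 2 ≤ (D.energy (HHalf.incl ι x)).toReal := by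
    have h := D.sum_le_of_energy_ne_top (D.mem_halfSubmodule.1 x.2) {i}
    rwa [Finset.sum_singleton] at h
  have h2 := h1.trans (hb x).2
  have hw := D.w_pos i
  rw [← Real.sqrt_sq (norm_nonneg x), ← Real.sqrt_mul (by positivity)]
  refine Real.abs_le_sqrt ?_
  rw [div_mul_eq_mul_div, le_div_iff₀ hw]
  linarith

theorem continuous_coord_half (D : WeightedBasis ι I) (i : I) :
    Continuous fun x : HHalf ι => D.coord i (HHalf.incl ι x) := by
  obtain ⟨C, hC⟩ := D.exists_coord_half_bound i
  exact AddMonoidHomClass.continuous_of_bound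
    ((D.coord i : H₀ →ₗ[ℝ] ℝ) ∘ₗ HHalf.incl ι) C hC

/-- The basis vectors as elements of `H_{1/2}`. -/
def vecHalf (D : WeightedBasis ι I) (i : I) : HHalf ι :=
  ⟨ι (D.vec i), D.mem_halfSubmodule.2 (by rw [energy_vec]; exact ENNReal.ofReal_ne_top)⟩

/-- The error is the tail of a convergent energy series. This is the convergence in the norm of
`H_{1/2}`, stronger than in `H₀`, that puts vectors into closed spans of eigenvectors. -/
theorem tendsto_sum_vecHalf (D : WeightedBasis ι I) (x : HHalf ι) :
    Tendsto (fun F : Finset I => ∑ i ∈ F, D.coord i (HHalf.incl ι x) • D.vecHalf i) atTop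
      (𝓝 x) := by
  obtain ⟨C, hC, hb⟩ := D.exists_norm_equiv
  have h1 := D.tendsto_energy_sub_sum (D.mem_halfSubmodule.1 x.2)
  have h2 := ((ENNReal.tendsto_toReal ENNReal.zero_ne_top).comp h1).const_mul C
  simp only [ENNReal.toReal_zero, mul_zero] at h2
  rw [tendsto_iff_norm_sub_tendsto_zero]
  have h3 : Tendsto (fun F : Finset I =>
      ‖(∑ i ∈ F, D.coord i (HHalf.incl ι x) • D.vecHalf i) - x‖ ^ 2) atTop (𝓝 0) := by
    refine squeeze_zero (fun F => by positivity) (fun F => ?_) h2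
    rw [norm_sub_rev]
    refine (hb _).1.trans (le_of_eq ?_)
    rw [map_sub, map_sum]
    simp only [map_smul]
    rfl
  have h4 := h3.sqrt
  simpa using h4

end WeightedBasis

theorem ext_incl {ι : H₁ →L[ℝ] H₀} {x y : HHalf ι} (h : HHalf.incl ι x = HHalf.incl ι y) :
    x = y :=
  Subtype.ext h

namespace SpectralBasis

variable {ι A : H₁ →L[ℝ] H₀} {I : Type*} [HilbertPair ι]

/-- The closed span of the eigenvectors whose eigenvalue has a given property, in coordinates. -/
theorem mem_closure_span_iff (D : SpectralBasis ι A I) (P : ℝ → Prop) (x : HHalf ι) :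
    x ∈ (Submodule.span ℝ {x : HHalf ι | ∃ (v : H₁) (a : ℝ), P a ∧ A v = a • ι v ∧
      HHalf.incl ι x = ι v}).topologicalClosure ↔
    ∀ i, ¬ P (D.a i) → D.coord i (HHalf.incl ι x) = 0 := by
  constructor
  · intro hx i hi
    have hcl : IsClosed {x : HHalf ι | D.coord i (HHalf.incl ι x) = 0} :=
      isClosed_eq (D.continuous_coord_half i) continuous_const
    refine closure_minimal (fun y hy => ?_) hcl hx
    have hy' : y ∈ Submodule.span ℝ {x : HHalf ι | ∃ (v : H₁) (a : ℝ), P a ∧ A v = a • ι v ∧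
      HHalf.incl ι x = ι v} := hy
    clear hy
    change D.coord i (HHalf.incl ι y) = 0
    induction hy' using Submodule.span_induction with
    | mem y hy =>
      obtain ⟨v, a, hPa, hv, hyv⟩ := hy
      rw [hyv]
      have h1 := D.coord_apply i v
      rw [hv, map_smul, smul_eq_mul] at h1
      -- An eigenvector has nonzero coordinates only at indices that carry its own eigenvalue.
      have h2 : (a - D.a i) * D.coord i (ι v) = 0 := by linarith
      refine (mul_eq_zero.1 h2).resolve_left fun h => hi ?_
      rwa [← sub_eq_zero.1 h]
    | zero => simp
    | add y z hy hz h1 h2 => rw [map_add, map_add, h1, h2, add_zero]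
    | smul c y hy h1 => rw [map_smul, map_smul, h1, smul_zero]
  · intro hx
    refine mem_closure_of_tendsto (D.tendsto_sum_vecHalf x) (Eventually.of_forall fun F => ?_)
    refine Submodule.sum_mem _ fun i _ => ?_
    by_cases hi : P (D.a i)
    · exact Submodule.smul_mem _ _ (Submodule.subset_span ⟨D.vec i, D.a i, hi, D.apply_vec i, rfl⟩)
    · rw [hx i hi, zero_smul]
      exact Submodule.zero_mem _

theorem mem_HPlus_iff (D : SpectralBasis ι A I) (x : HHalf ι) :
    x ∈ HPlus ι A ↔ ∀ i, D.a i < 0 → D.coord i (HHalf.incl ι x) = 0 := by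
  refine (D.mem_closure_span_iff (fun a => 0 < a) x).trans (forall_congr' fun i => ?_)
  rw [not_lt]
  exact ⟨fun h hi => h hi.le, fun h hi => h (lt_of_le_of_ne hi (D.a_ne_zero i))⟩

theorem mem_HMinus_iff (D : SpectralBasis ι A I) (x : HHalf ι) :
    x ∈ HMinus ι A ↔ ∀ i, 0 < D.a i → D.coord i (HHalf.incl ι x) = 0 := by
  refine (D.mem_closure_span_iff (fun a => a < 0) x).trans (forall_congr' fun i => ?_)
  rw [not_lt]
  exact ⟨fun h hi => h hi.le, fun h hi => h (lt_of_le_of_ne hi (D.a_ne_zero i).symm)⟩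

/-- The spectral decomposition of `H_{1/2}`. -/
theorem isCompl (D : SpectralBasis ι A I) : IsCompl (HPlus ι A) (HMinus ι A) := by
  constructor
  · rw [Submodule.disjoint_def]
    intro x h1 h2
    rw [D.mem_HPlus_iff] at h1
    rw [D.mem_HMinus_iff] at h2
    refine ext_incl (ι := ι) ?_
    rw [map_zero]
    refine D.eq_zero_of_coord fun i => ?_
    rcases lt_or_gt_of_ne (D.a_ne_zero i) with h | h
    · exact h1 i h
    · exact h2 i h
  · rw [Submodule.codisjoint_iff_exists_add_eq]
    intro x
    -- The positive component is obtained by erasing coordinates, which does not increase the energy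
    -- and hence stays in `H_{1/2}`.
    obtain ⟨y, hy⟩ := D.exists_restrict {i | 0 < D.a i} (HHalf.incl ι x)
    have hle : D.energy y ≤ D.energy (HHalf.incl ι x) := by
      refine D.energy_mono fun i => ?_
      rw [hy]
      by_cases hi : i ∈ {i | 0 < D.a i}
      · rw [indicator_of_mem hi]
      · rw [indicator_of_notMem hi, zero_pow two_ne_zero]
        positivity
    let y' : HHalf ι := ⟨y, D.mem_halfSubmodule.2
      (ne_top_of_le_ne_top (D.mem_halfSubmodule.1 x.2) hle)⟩
    have hy' : HHalf.incl ι y' = y := rfl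
    refine ⟨y', x - y', ?_, ?_, by abel⟩
    · rw [D.mem_HPlus_iff]
      intro i hi
      rw [hy', hy]
      exact indicator_of_notMem (s := {i | 0 < D.a i}) (hi.le.not_gt) _
    · rw [D.mem_HMinus_iff]
      intro i hi
      rw [map_sub, map_sub, hy', hy, indicator_of_mem (show i ∈ {i | 0 < D.a i} from hi), sub_self]

/-- The positive part of the energy is controlled by the spectral projection. -/
theorem exists_sum_le_projPlus (D : SpectralBasis ι A I)
    (hπ : IsCompl (HPlus ι A) (HMinus ι A)) : ∃ C : ℝ, 0 < C ∧ ∀ (x : HHalf ι) (F : Finset I),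
      ∑ i ∈ F, D.a i * D.coord i (HHalf.incl ι x) ^ 2 ≤ C * ‖projPlus ι A hπ x‖ ^ 2 := by
  obtain ⟨C, hC, hb⟩ := D.exists_norm_equiv
  refine ⟨C, hC, fun x F => ?_⟩
  set y := projPlus ι A hπ x
  -- Elements of `H⁻` have no coordinates at positive eigenvalues, so there `x` and its projection
  -- agree. Terms with a negative eigenvalue are nonpositive and are dropped.
  have h2 : x - y ∈ HMinus ι A := Submodule.sub_projection_mem hπ x
  rw [D.mem_HMinus_iff] at h2
  refine le_trans (Finset.sum_le_sum fun i _ => ?_)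
    ((D.sum_le_of_energy_ne_top (D.mem_halfSubmodule.1 y.2) F).trans (hb y).2)
  change D.a i * D.coord i (HHalf.incl ι x) ^ 2 ≤ D.w i * D.coord i (HHalf.incl ι y) ^ 2
  rcases lt_or_gt_of_ne (D.a_ne_zero i) with h | h
  · have h3 := D.w_pos i
    have h4 := sq_nonneg (D.coord i (HHalf.incl ι x))
    have h5 : 0 ≤ D.w i * D.coord i (HHalf.incl ι y) ^ 2 := by positivity
    nlinarith
  · have h3 := h2 i h
    rw [map_sub, map_sub, sub_eq_zero] at h3
    rw [h3, D.w_eq, abs_of_pos h]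

end SpectralBasis

/-! ### The half line estimate for a constant invertible operator -/

/-- The images of balls under the compact map `ι` are relatively compact, hence separable, and their
union is dense. -/
theorem HilbertPair.separableSpace (ι : H₁ →L[ℝ] H₀) [HilbertPair ι] :
    TopologicalSpace.SeparableSpace H₀ := by
  rw [← TopologicalSpace.isSeparable_univ_iff]
  have h1 : TopologicalSpace.IsSeparable (⋃ n : ℕ, closure (ι '' Metric.closedBall 0 (n : ℝ))) :=
    TopologicalSpace.IsSeparable.iUnion fun n =>
      (IsCompactOperator.isCompact_closure_image_closedBall (f := (ι : H₁ →ₗ[ℝ] H₀))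
        (HilbertPair.compact (ι := ι)) n).isSeparable
  refine h1.closure.mono ?_
  rw [← (HilbertPair.denseRange (ι := ι)).closure_range]
  refine closure_mono ?_
  rintro _ ⟨y, rfl⟩
  obtain ⟨n, hn⟩ := exists_nat_ge ‖y‖
  exact mem_iUnion.2 ⟨n, subset_closure ⟨y, by simpa using hn, rfl⟩⟩

namespace WeightedBasis

variable {ι : H₁ →L[ℝ] H₀} {I : Type*}

/-- By the Bessel inequality in coordinate `i`, `1 ≤ K ‖ι (vec i) - ι (vec j)‖²`, so the basis
vectors are uniformly separated in a separable space. Countability is needed to exchange the sum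
over the basis with the integral. -/
theorem countable [HilbertPair ι] (D : WeightedBasis ι I) : Countable I := by
  have hsep := HilbertPair.separableSpace ι
  obtain ⟨r, hr, hrK⟩ : ∃ r : ℝ, 0 < r ∧ D.K * (2 * r) ^ 2 < 1 := by
    refine ⟨1 / (2 * (D.K + 1)), ?_, ?_⟩
    · have := D.K_pos
      positivity
    · have hK := D.K_pos
      have : D.K * (2 * (1 / (2 * (D.K + 1)))) ^ 2 = D.K / (D.K + 1) ^ 2 := by
        field_simp
      rw [this, div_lt_one (by positivity)]
      nlinarith
  refine Pairwise.countable_of_isOpen_disjoint (s := fun i => Metric.ball (ι (D.vec i)) r)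
    (fun i j hij => ?_) (fun i => Metric.isOpen_ball) (fun i => ⟨_, Metric.mem_ball_self hr⟩)
  refine Metric.ball_disjoint_ball ?_
  by_contra hlt
  push Not at hlt
  rw [dist_eq_norm, ← two_mul] at hlt
  have h1 := D.bessel_zero (ι (D.vec i) - ι (D.vec j)) {i}
  rw [Finset.sum_singleton, map_sub, D.coord_self, D.coord_ne i j hij] at h1
  have h2 : ‖ι (D.vec i) - ι (D.vec j)‖ ^ 2 ≤ (2 * r) ^ 2 :=
    pow_le_pow_left₀ (norm_nonneg _) hlt.le 2
  have h3 := mul_le_mul_of_nonneg_left h2 D.K_pos.le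
  norm_num at h1
  linarith

theorem ofReal_norm_sq_le (D : WeightedBasis ι I) (x : H₀) :
    ENNReal.ofReal (‖x‖ ^ 2) ≤ ENNReal.ofReal D.K * ∑' i, ENNReal.ofReal (D.coord i x ^ 2) := by
  have hlim := ENNReal.tendsto_ofReal (((D.hasSum x).norm).pow 2)
  refine le_of_tendsto' hlim fun F => ?_
  refine (ENNReal.ofReal_le_ofReal (D.synthesis_zero _ F)).trans ?_
  rw [ENNReal.ofReal_mul D.K_pos.le, ENNReal.ofReal_sum_of_nonneg fun i _ => sq_nonneg _]
  gcongr
  exact ENNReal.sum_le_tsum F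

/-- An `L²` bound from bounds on finitely many coordinates. -/
theorem integral_norm_sq_le [HilbertPair ι] (D : WeightedBasis ι I) {v : ℝ → H₀}
    (hv : MemLp v 2 halfLine) {M : ℝ}
    (h : ∀ F : Finset I, ∑ i ∈ F, ∫ s in Ici (0 : ℝ), D.coord i (v s) ^ 2 ≤ M) :
    ∫ s in Ici (0 : ℝ), ‖v s‖ ^ 2 ≤ D.K * M := by
  have hc := D.countable
  have hM : 0 ≤ M := by simpa using h ∅
  have hi : ∀ i, Integrable (fun s => D.coord i (v s) ^ 2) halfLine := fun i =>
    ((D.coord i).comp_memLp' hv).integrable_sq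
  have hvi : Integrable (fun s => ‖v s‖ ^ 2) halfLine := hv.integrable_norm_pow (by simp)
  rw [← ENNReal.ofReal_le_ofReal_iff (mul_nonneg D.K_pos.le hM),
    ofReal_integral_eq_lintegral_ofReal hvi (Eventually.of_forall fun s => by positivity)]
  have hmeas : ∀ i, AEMeasurable (fun s => ENNReal.ofReal (D.coord i (v s) ^ 2)) halfLine :=
    fun i => (hi i).aestronglyMeasurable.aemeasurable.ennreal_ofReal
  calc ∫⁻ s in Ici (0 : ℝ), ENNReal.ofReal (‖v s‖ ^ 2)
      ≤ ∫⁻ s in Ici (0 : ℝ), ENNReal.ofReal D.K * ∑' i, ENNReal.ofReal (D.coord i (v s) ^ 2) :=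
        lintegral_mono fun s => D.ofReal_norm_sq_le _
    _ = ENNReal.ofReal D.K * ∑' i, ∫⁻ s in Ici (0 : ℝ), ENNReal.ofReal (D.coord i (v s) ^ 2) := by
        rw [lintegral_const_mul' _ _ ENNReal.ofReal_ne_top, lintegral_tsum hmeas]
    _ ≤ ENNReal.ofReal D.K * ENNReal.ofReal M := by
        gcongr
        rw [ENNReal.tsum_eq_iSup_sum]
        refine iSup_le fun F => ?_
        refine le_trans (le_of_eq ?_) (ENNReal.ofReal_le_ofReal (h F))
        rw [ENNReal.ofReal_sum_of_nonneg fun i _ => integral_nonneg fun s => sq_nonneg _]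
        exact Finset.sum_congr rfl fun i _ =>
          (ofReal_integral_eq_lintegral_ofReal (hi i)
            (Eventually.of_forall fun s => sq_nonneg _)).symm
    _ = ENNReal.ofReal (D.K * M) := (ENNReal.ofReal_mul D.K_pos.le).symm

end WeightedBasis

namespace SpectralBasis

variable {ι A : H₁ →L[ℝ] H₀} {I : Type*}

/-- The scalar identity behind the whole estimate: the mixed term `2 a ∫ x x'` of `∫ (x' + a x)²`
equals `-a x(0)²`. The hypothesis bounds the signed sum, so negative eigenvalues can only help. -/
theorem sum_component_le (D : SpectralBasis ι A I) {u : ℝ → H₁} {v f : ℝ → H₀}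
    (h : IsTrajectory ι u v f) {M : ℝ}
    (hM : ∀ F : Finset I, ∑ i ∈ F, D.a i * D.coord i (f 0) ^ 2 ≤ M) (F : Finset I) :
    (∑ i ∈ F, ∫ s in Ici (0 : ℝ), D.coord i (v s) ^ 2) +
      (∑ i ∈ F, ∫ s in Ici (0 : ℝ), D.coord i (A (u s)) ^ 2) ≤
    D.K * (∫ s in Ici (0 : ℝ), ‖v s + A (u s)‖ ^ 2) + M := by
  have hAu : MemLp (fun s => A (u s)) 2 halfLine := A.comp_memLp' h.memLp_path
  have hw : MemLp (fun s => v s + A (u s)) 2 halfLine := h.memLp_deriv.add hAu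
  have i1 : ∀ i, Integrable (fun s => D.coord i (v s) ^ 2) halfLine := fun i =>
    ((D.coord i).comp_memLp' h.memLp_deriv).integrable_sq
  have i2 : ∀ i, Integrable (fun s => D.coord i (A (u s)) ^ 2) halfLine := fun i =>
    ((D.coord i).comp_memLp' hAu).integrable_sq
  have i3 : ∀ i, Integrable (fun s => D.coord i (v s + A (u s)) ^ 2) halfLine := fun i =>
    ((D.coord i).comp_memLp' hw).integrable_sq
  have key : ∀ i, (∫ s in Ici (0 : ℝ), D.coord i (v s) ^ 2) +
      (∫ s in Ici (0 : ℝ), D.coord i (A (u s)) ^ 2) =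
      (∫ s in Ici (0 : ℝ), D.coord i (v s + A (u s)) ^ 2) + D.a i * D.coord i (f 0) ^ 2 := by
    intro i
    obtain ⟨i4, he⟩ := h.integral_component (D.coord i)
    have h1 : ∫ s in Ici (0 : ℝ), D.coord i (v s + A (u s)) ^ 2 =
        ∫ s in Ici (0 : ℝ), (D.coord i (v s) ^ 2 + D.coord i (A (u s)) ^ 2 +
          2 * D.a i * (D.coord i (f s) * D.coord i (v s))) := by
      refine integral_congr_ae ?_
      filter_upwards [h.ae_eq] with s hs
      rw [map_add, D.coord_apply, hs]
      ring
    have i5 : Integrable (fun s => D.coord i (v s) ^ 2 + D.coord i (A (u s)) ^ 2) halfLine :=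
      (i1 i).add (i2 i)
    rw [h1, integral_add i5 (i4.const_mul _), integral_add (i1 i) (i2 i), integral_const_mul]
    linear_combination (-D.a i) * he
  rw [← Finset.sum_add_distrib, Finset.sum_congr rfl fun i _ => key i, Finset.sum_add_distrib]
  refine add_le_add ?_ (hM F)
  rw [← integral_finsetSum F fun i _ => i3 i, ← integral_const_mul]
  exact integral_mono (integrable_finsetSum F fun i _ => i3 i)
    ((hw.integrable_norm_pow (by simp)).const_mul _) fun s => D.bessel_zero _ F

/-- The half line estimate. -/
theorem exists_halfLine_estimate [HilbertPair ι] (D : SpectralBasis ι A I)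
    (hA : A.IsInvertible) : ∃ C : ℝ, 0 < C ∧ ∀ {u : ℝ → H₁} {v f : ℝ → H₀},
      IsTrajectory ι u v f → ∀ M : ℝ,
      (∀ F : Finset I, ∑ i ∈ F, D.a i * D.coord i (f 0) ^ 2 ≤ M) →
      (∫ s in Ici (0 : ℝ), ‖u s‖ ^ 2) + (∫ s in Ici (0 : ℝ), ‖v s‖ ^ 2) ≤
        C * ((∫ s in Ici (0 : ℝ), ‖v s + A (u s)‖ ^ 2) + M) := by
  obtain ⟨e, rfl⟩ := hA
  set R : H₀ →L[ℝ] H₁ := (e.symm : H₀ →L[ℝ] H₁)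
  have hK := D.K_pos
  refine ⟨(‖R‖ ^ 2 + 1) * (D.K * (D.K + 1)), by positivity, fun {u v f} h M hM => ?_⟩
  have hM0 : 0 ≤ M := by simpa using hM ∅
  have hAu : MemLp (fun s => e (u s)) 2 halfLine :=
    (e : H₁ →L[ℝ] H₀).comp_memLp' h.memLp_path
  set N : ℝ := D.K * (∫ s in Ici (0 : ℝ), ‖v s + e (u s)‖ ^ 2) + M
  set Q : ℝ := ∫ s in Ici (0 : ℝ), ‖v s + e (u s)‖ ^ 2
  have hQ : 0 ≤ Q := integral_nonneg fun s => by positivity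
  have hsum := D.sum_component_le h hM
  have h1 : ∫ s in Ici (0 : ℝ), ‖v s‖ ^ 2 ≤ D.K * N := by
    refine D.integral_norm_sq_le h.memLp_deriv fun F => le_trans ?_ (hsum F)
    exact le_add_of_nonneg_right
      (Finset.sum_nonneg fun i _ => integral_nonneg fun s => sq_nonneg _)
  have h2 : ∫ s in Ici (0 : ℝ), ‖e (u s)‖ ^ 2 ≤ D.K * N := by
    refine D.integral_norm_sq_le hAu fun F => le_trans ?_ (hsum F)
    exact le_add_of_nonneg_left
      (Finset.sum_nonneg fun i _ => integral_nonneg fun s => sq_nonneg _)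
  -- The eigenbasis bounds `A u` in `H₀`; the bounded inverse turns this into a bound of `u` in
  -- `H₁`.
  have h3 : ∫ s in Ici (0 : ℝ), ‖u s‖ ^ 2 ≤ ‖R‖ ^ 2 * ∫ s in Ici (0 : ℝ), ‖e (u s)‖ ^ 2 := by
    rw [← integral_const_mul]
    refine integral_mono (h.memLp_path.integrable_norm_pow (by simp))
      ((hAu.integrable_norm_pow (by simp)).const_mul _) fun s => ?_
    have h4 := sq_norm_apply_le R (e (u s))
    simpa [R] using h4
  have h5 : N ≤ (D.K + 1) * (Q + M) := by
    change D.K * Q + M ≤ _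
    nlinarith
  calc _ ≤ ‖R‖ ^ 2 * (D.K * N) + D.K * N := by
        refine add_le_add (h3.trans ?_) h1
        gcongr
    _ = (‖R‖ ^ 2 + 1) * (D.K * N) := by ring
    _ ≤ (‖R‖ ^ 2 + 1) * (D.K * ((D.K + 1) * (Q + M))) := by gcongr
    _ = (‖R‖ ^ 2 + 1) * (D.K * (D.K + 1)) * (Q + M) := by ring

end SpectralBasis

/-! ### Invertible corrections of Hessians -/

/-- A Hessian becomes invertible after adding the projection to its kernel. -/
theorem IsHessian.exists_correction {ι A : H₁ →L[ℝ] H₀} [HilbertPair ι] (hA : IsHessian ι A) :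
    ∃ Q : H₀ →L[ℝ] H₀, IsSymmetrizable ι (A + Q ∘L ι) ∧ (A + Q ∘L ι).IsInvertible := by
  obtain ⟨p, hp, hsym⟩ := hA.symmetrizable
  have hker : FiniteDimensional ℝ A.ker := hA.fredholm.finite_ker
  have hcoker : FiniteDimensional ℝ (H₀ ⧸ A.range) := hA.fredholm.finite_coker
  obtain ⟨E, i1, i2, i3, Ψ, hΨ⟩ := exists_innerModel p hp
  let P : H₀ →L[ℝ] E := (Ψ : H₀ →L[ℝ] E)
  let W : Submodule ℝ E := A.ker.map ((P ∘L ι : H₁ →L[ℝ] E) : H₁ →ₗ[ℝ] E)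
  have hW : FiniteDimensional ℝ W := inferInstance
  let Q : H₀ →L[ℝ] H₀ := (Ψ.symm : E →L[ℝ] H₀) ∘L W.starProjection ∘L P
  have hΨQ : ∀ x, Ψ (Q x) = W.starProjection (Ψ x) := fun x => by simp [Q, P]
  have hQker : ∀ k ∈ A.ker, Q (ι k) = ι k := by
    intro k hk
    apply Ψ.injective
    rw [hΨQ]
    exact Submodule.starProjection_eq_self_iff.2 ⟨k, hk, rfl⟩
  have hQmem : ∀ x, ∃ k ∈ A.ker, Q x = ι k := by
    intro x
    obtain ⟨k, hk, hkx⟩ := W.starProjection_apply_mem (Ψ x)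
    refine ⟨k, hk, Ψ.injective ?_⟩
    rw [hΨQ, ← hkx]
    rfl
  have hQsym : ∀ x y, p.inner (Q x) y = p.inner x (Q y) := by
    intro x y
    rw [← hΨ, ← hΨ, hΨQ, hΨQ]
    exact W.inner_starProjection_left_eq_right _ _
  -- By symmetry the range of `A` is orthogonal, for the symmetrizing inner product, to `ι (ker A)`.
  -- Injectivity and surjectivity below both rest on this.
  have horth : ∀ x, ∀ k ∈ A.ker, inner ℝ (Ψ (A x)) (Ψ (ι k)) = 0 := by
    intro x k hk
    have hk' : A k = 0 := hk
    rw [hΨ, hsym, hk', ← hΨ, map_zero, inner_zero_right]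
  have hιinj := HilbertPair.injective (ι := ι)
  refine ⟨Q, ⟨p, hp, fun x y => ?_⟩, ?_⟩
  · have h1 : p.inner ((A + Q ∘L ι) x) (ι y) = p.inner (A x) (ι y) + p.inner (Q (ι x)) (ι y) := by
      simp only [← hΨ, add_apply, ContinuousLinearMap.comp_apply, map_add,
        inner_add_left]
    have h2 : p.inner (ι x) ((A + Q ∘L ι) y) = p.inner (ι x) (A y) + p.inner (ι x) (Q (ι y)) := by
      simp only [← hΨ, add_apply, ContinuousLinearMap.comp_apply, map_add,
        inner_add_right]
    rw [h1, h2, hsym, hQsym]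
  · have hinj : ∀ x, (A + Q ∘L ι) x = 0 → x = 0 := by
      intro x hx
      obtain ⟨k, hk, hkx⟩ := hQmem (ι x)
      have hx' : A x + ι k = 0 := by rw [← hkx]; exact hx
      have hk0 : ι k = 0 := by
        apply Ψ.injective
        rw [map_zero, ← inner_self_eq_zero (𝕜 := ℝ)]
        have h1 := horth x k hk
        rw [eq_neg_of_add_eq_zero_left hx', map_neg, inner_neg_left, neg_eq_zero] at h1
        exact h1
      have hxk : x ∈ A.ker := by
        change A x = 0
        rw [← hx', hk0, add_zero]
      rw [hk0, hQker x hxk] at hkx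
      exact hιinj (by rw [hkx, map_zero])
    -- By orthogonality `ker A` embeds into the cokernel of `A`; index zero makes the dimensions
    -- equal, so `H₀` is the sum of the range of `A` and `ι (ker A)`.
    have hsurj : ∀ z, ∃ x, (A + Q ∘L ι) x = z := by
      let L : A.ker →ₗ[ℝ] H₀ ⧸ A.range :=
        A.range.mkQ ∘ₗ (ι : H₁ →ₗ[ℝ] H₀) ∘ₗ A.ker.subtype
      have hL : Function.Injective L := by
        rw [injective_iff_map_eq_zero]
        intro k hk
        have hk' : ι k ∈ A.range := (Submodule.Quotient.mk_eq_zero _).1 hk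
        obtain ⟨x, hx⟩ := hk'
        have hx : A x = ι k := hx
        have h1 := horth x k k.2
        rw [hx, inner_self_eq_zero] at h1
        have h2 : ι k = 0 := Ψ.injective (by rw [h1, map_zero])
        exact Subtype.ext (hιinj (by rw [h2]; simp))
      have hLs : Function.Surjective L :=
        (LinearMap.injective_iff_surjective_of_finrank_eq_finrank hA.index_zero).1 hL
      intro z
      obtain ⟨k, hk⟩ := hLs (A.range.mkQ z)
      have hmem : z - ι k ∈ A.range := by
        rw [← Submodule.Quotient.mk_eq_zero, Submodule.Quotient.mk_sub, sub_eq_zero]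
        exact hk.symm
      obtain ⟨x, hx⟩ := hmem
      have hx : A x = z - ι k := hx
      obtain ⟨k', hk', hkx⟩ := hQmem (ι x)
      -- Kernel elements do not change `A x = z - ι k`, while `Q` maps `ι x` to `ι k'` and fixes `ι
      -- (k - k')`; the total is `z`.
      refine ⟨x + (k - k'), ?_⟩
      have h1 : A ((k : H₁) - k') = 0 := (A.ker.sub_mem k.2 hk' : _)
      have h2 := hQker _ (A.ker.sub_mem k.2 hk')
      rw [add_apply, ContinuousLinearMap.comp_apply, map_add, h1, map_add,
        map_add, h2, hkx, hx, map_sub]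
      abel
    exact ⟨ContinuousLinearEquiv.ofBijective (A + Q ∘L ι)
      (LinearMap.ker_eq_bot'.2 hinj) (LinearMap.range_eq_top.2 hsurj), rfl⟩

/-! ### Perturbation and localization -/

/-- The half line estimate for an operator, with a predicate that bounds the trace at zero. -/
def HalfLineEstimate (ι B : H₁ →L[ℝ] H₀) (Tr : H₀ → ℝ → Prop) (C : ℝ) : Prop :=
  ∀ {u : ℝ → H₁} {v f : ℝ → H₀}, IsTrajectory ι u v f → ∀ M : ℝ, Tr (f 0) M →
    (∫ s in Ici (0 : ℝ), ‖u s‖ ^ 2) + (∫ s in Ici (0 : ℝ), ‖v s‖ ^ 2) ≤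
      C * ((∫ s in Ici (0 : ℝ), ‖v s + B (u s)‖ ^ 2) + M)

/-- The bound for the trace at zero that is used with a spectral basis. -/
def SpectralBasis.TraceBound {ι A : H₁ →L[ℝ] H₀} {I : Type*} (D : SpectralBasis ι A I) (x : H₀)
    (M : ℝ) : Prop :=
  ∀ F : Finset I, ∑ i ∈ F, D.a i * D.coord i x ^ 2 ≤ M

theorem norm_sq_add_three_le {E : Type*} [NormedAddCommGroup E] (x y z : E) :
    ‖x + y + z‖ ^ 2 ≤ 3 * (‖x‖ ^ 2 + ‖y‖ ^ 2 + ‖z‖ ^ 2) := by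
  have h1 : ‖x + y + z‖ ≤ ‖x‖ + ‖y‖ + ‖z‖ := norm_add₃_le
  have h2 := pow_le_pow_left₀ (norm_nonneg _) h1 2
  nlinarith [sq_nonneg (‖x‖ - ‖y‖), sq_nonneg (‖x‖ - ‖z‖), sq_nonneg (‖y‖ - ‖z‖)]

theorem norm_sq_add_two_le {E : Type*} [NormedAddCommGroup E] (x y : E) :
    ‖x + y‖ ^ 2 ≤ 2 * (‖x‖ ^ 2 + ‖y‖ ^ 2) := by
  have h1 : ‖x + y‖ ≤ ‖x‖ + ‖y‖ := norm_add_le _ _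
  have h2 := pow_le_pow_left₀ (norm_nonneg _) h1 2
  nlinarith [sq_nonneg (‖x‖ - ‖y‖)]

/-- The half line estimate under a small perturbation and a perturbation of order zero. -/
theorem HalfLineEstimate.perturb {ι A₀ : H₁ →L[ℝ] H₀} {Q : H₀ →L[ℝ] H₀} {Tr : H₀ → ℝ → Prop}
    {C ε : ℝ} (h : HalfLineEstimate ι (A₀ + Q ∘L ι) Tr C) (hC : 0 < C) (hε : 6 * C * ε ^ 2 ≤ 1)
    {A : ℝ → H₁ →L[ℝ] H₀} {u : ℝ → H₁} {v f : ℝ → H₀} (ht : IsTrajectory ι u v f)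
    (hAu : MemLp (fun s => A s (u s)) 2 halfLine)
    (hclose : ∀ᵐ s ∂halfLine, ‖(A₀ - A s) (u s)‖ ≤ ε * ‖u s‖) {M : ℝ} (hM : Tr (f 0) M) :
    (∫ s in Ici (0 : ℝ), ‖u s‖ ^ 2) + (∫ s in Ici (0 : ℝ), ‖v s‖ ^ 2) ≤
      2 * C * (3 * (∫ s in Ici (0 : ℝ), ‖v s + A s (u s)‖ ^ 2) +
        3 * (∫ s in Ici (0 : ℝ), ‖Q (ι (u s))‖ ^ 2) + M) := by
  have i0 : Integrable (fun s => ‖u s‖ ^ 2) halfLine :=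
    ht.memLp_path.integrable_norm_pow (by simp)
  have i1 : Integrable (fun s => ‖v s + A s (u s)‖ ^ 2) halfLine :=
    (ht.memLp_deriv.add hAu).integrable_norm_pow (by simp)
  have i2 : Integrable (fun s => ‖Q (ι (u s))‖ ^ 2) halfLine :=
    ((Q ∘L ι).comp_memLp' ht.memLp_path).integrable_norm_pow (by simp)
  have i3 : Integrable (fun s => ‖v s + (A₀ + Q ∘L ι) (u s)‖ ^ 2) halfLine :=
    (ht.memLp_deriv.add ((A₀ + Q ∘L ι).comp_memLp' ht.memLp_path)).integrable_norm_pow (by simp)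
  have h1 := h ht M hM
  have h2 : ∫ s in Ici (0 : ℝ), ‖v s + (A₀ + Q ∘L ι) (u s)‖ ^ 2 ≤
      3 * ((∫ s in Ici (0 : ℝ), ‖v s + A s (u s)‖ ^ 2) +
        ε ^ 2 * (∫ s in Ici (0 : ℝ), ‖u s‖ ^ 2) +
        ∫ s in Ici (0 : ℝ), ‖Q (ι (u s))‖ ^ 2) := by
    have i4 : Integrable (fun s => ‖v s + A s (u s)‖ ^ 2 + ε ^ 2 * ‖u s‖ ^ 2) halfLine :=
      i1.add (i0.const_mul _)
    rw [← integral_const_mul (ε ^ 2), ← integral_add i1 (i0.const_mul _), ← integral_add i4 i2,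
      ← integral_const_mul]
    refine integral_mono_ae i3 ((i4.add i2).const_mul _) ?_
    filter_upwards [hclose] with s hs
    have e : v s + (A₀ + Q ∘L ι) (u s) =
        (v s + A s (u s)) + (A₀ - A s) (u s) + Q (ι (u s)) := by
      simp only [add_apply, sub_apply, ContinuousLinearMap.comp_apply]
      abel
    have h3 : ‖(A₀ - A s) (u s)‖ ^ 2 ≤ ε ^ 2 * ‖u s‖ ^ 2 := by
      rw [← mul_pow]
      exact pow_le_pow_left₀ (norm_nonneg _) hs 2
    rw [e]
    refine (norm_sq_add_three_le _ _ _).trans ?_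
    linarith
  have hU : 0 ≤ ∫ s in Ici (0 : ℝ), ‖u s‖ ^ 2 := integral_nonneg fun s => by positivity
  have hV : 0 ≤ ∫ s in Ici (0 : ℝ), ‖v s‖ ^ 2 := integral_nonneg fun s => by positivity
  have h4 := mul_le_mul_of_nonneg_left (add_le_add_left h2 M) hC.le
  -- The choice of `ε` makes `3 C ε² ∫ ‖u‖²` at most half of `∫ ‖u‖²`, which is absorbed on the left
  -- at the price of the factor `2`.
  have h5 := mul_le_mul_of_nonneg_right hε hU
  nlinarith

/-! ### Cutoff functions and the localized estimate -/

/-- The weak derivative of a function that is multiplied by a smooth one. -/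
theorem HasWeakDeriv.smul {ι : H₁ →L[ℝ] H₀} {u : ℝ → H₁} {v : ℝ → H₀}
    (hu : MemLp u 2 halfLine) (hv : MemLp v 2 halfLine)
    (h : HasWeakDeriv (fun s => ι (u s)) v) {β : ℝ → ℝ} (hβ : ContDiff ℝ ∞ β) :
    HasWeakDeriv (fun s => ι (β s • u s)) (fun s => β s • v s + deriv β s • ι (u s)) := by
  intro φ h1 h2 h3
  have hφ : Continuous (deriv φ) := h1.continuous_deriv (by simp)
  have hβ' : Continuous (deriv β) := hβ.continuous_deriv (by simp)
  have hc : HasCompactSupport (fun s => φ s * β s) := h2.mul_right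
  have hι : MemLp (fun s => ι (u s)) 2 halfLine := ι.comp_memLp' hu
  have hw := h (fun s => φ s * β s) (h1.mul hβ) hc
    ((tsupport_mul_subset_left (f := φ) (g := β)).trans h3)
  have hd : ∀ s, deriv (fun s => φ s * β s) s = deriv φ s * β s + φ s * deriv β s := fun s =>
    deriv_fun_mul (h1.differentiable (by simp)).differentiableAt
      (hβ.differentiable (by simp)).differentiableAt
  have j1 : Integrable (fun s => (deriv φ s * β s) • ι (u s)) halfLine :=
    integrable_smul_of_compactSupport (hφ.mul hβ.continuous) h2.deriv.mul_right hι
  have j2 : Integrable (fun s => (φ s * deriv β s) • ι (u s)) halfLine :=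
    integrable_smul_of_compactSupport (h1.continuous.mul hβ') h2.mul_right hι
  have j3 : Integrable (fun s => (φ s * β s) • v s) halfLine :=
    integrable_smul_of_compactSupport (h1.continuous.mul hβ.continuous) hc hv
  simp only [hd, add_smul] at hw
  rw [integral_add j1 j2] at hw
  have e1 : ∫ s in Ici (0 : ℝ), deriv φ s • ι (β s • u s) =
      ∫ s in Ici (0 : ℝ), (deriv φ s * β s) • ι (u s) := by
    simp only [map_smul, smul_smul]
  have e2 : ∫ s in Ici (0 : ℝ), φ s • (β s • v s + deriv β s • ι (u s)) =
      (∫ s in Ici (0 : ℝ), (φ s * β s) • v s) +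
        ∫ s in Ici (0 : ℝ), (φ s * deriv β s) • ι (u s) := by
    simp only [smul_add, smul_smul]
    exact integral_add j3 j2
  rw [e1, e2, neg_add, ← hw]
  abel

theorem HasWeakDeriv.exists_isTrajectory {ι : H₁ →L[ℝ] H₀} {u : ℝ → H₁} {v : ℝ → H₀}
    (hu : MemLp u 2 halfLine) (hv : MemLp v 2 halfLine)
    (h : HasWeakDeriv (fun s => ι (u s)) v) : ∃ f, IsTrajectory ι u v f := by
  obtain ⟨x, hx⟩ := h.exists_primitive (ι.comp_memLp' hu) hv
  refine ⟨fun s => x + ∫ t in (0 : ℝ)..s, v t, hu, hv, ?_, fun s _ => by simp⟩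
  filter_upwards [hx] with s hs
  exact hs.symm

theorem memLp_smul_of_bounded {E : Type*} [NormedAddCommGroup E] [NormedSpace ℝ E] {β : ℝ → ℝ}
    (hβ : Continuous β) {m : ℝ} (hm : ∀ s, |β s| ≤ m) {u : ℝ → E} (hu : MemLp u 2 halfLine) :
    MemLp (fun s => β s • u s) 2 halfLine := by
  refine hu.of_le_mul (c := m) (hβ.aestronglyMeasurable.smul hu.1)
    (Eventually.of_forall fun s => ?_)
  rw [norm_smul]
  exact mul_le_mul_of_nonneg_right (hm s) (norm_nonneg _)

/-- A path times a cutoff function. -/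
theorem IsTrajectory.cutoff {ι : H₁ →L[ℝ] H₀} {u : ℝ → H₁} {v f : ℝ → H₀}
    (h : IsTrajectory ι u v f) (hw : HasWeakDeriv (fun s => ι (u s)) v) {β : ℝ → ℝ}
    (hβ : ContDiff ℝ ∞ β) {m : ℝ} (hm : ∀ s, |β s| ≤ m) (hm' : ∀ s, |deriv β s| ≤ m) :
    IsTrajectory ι (fun s => β s • u s) (fun s => β s • v s + deriv β s • ι (u s))
      (fun s => β s • f s) := by
  have hβ' : Continuous (deriv β) := hβ.continuous_deriv (by simp)
  have h1 := memLp_smul_of_bounded hβ.continuous hm h.memLp_path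
  have h2 := (memLp_smul_of_bounded hβ.continuous hm h.memLp_deriv).add
    (memLp_smul_of_bounded hβ' hm' (ι.comp_memLp' h.memLp_path))
  obtain ⟨g, hg⟩ := (hw.smul h.memLp_path h.memLp_deriv hβ).exists_isTrajectory h1 h2
  have hae : (fun s => β s • f s) =ᵐ[halfLine] fun s => ι (β s • u s) := by
    filter_upwards [h.ae_eq] with s hs
    rw [hs, map_smul]
  -- Continuous representatives that agree almost everywhere agree up to the endpoint; this fixes
  -- the trace of the cut off path as `β 0 • f 0`.
  have heq := eqOn_Ici_of_ae_eq hg.continuousOn (hβ.continuous.continuousOn.smul h.continuousOn)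
    (hg.ae_eq.trans hae.symm)
  refine ⟨h1, h2, hae, fun s hs => ?_⟩
  have e1 : g s = β s • f s := heq (show s ∈ Ici (0 : ℝ) from hs)
  have e2 : g 0 = β 0 • f 0 := heq (show (0 : ℝ) ∈ Ici (0 : ℝ) from self_mem_Ici)
  rw [← e1, ← e2]
  exact hg.eq_primitive s hs

/-- The half line estimate, localized by a cutoff function. -/
theorem HalfLineEstimate.exists_cutoff_bound {ι A₀ : H₁ →L[ℝ] H₀} {Q : H₀ →L[ℝ] H₀}
    {Tr Tr₀ : H₀ → ℝ → Prop} {C ε : ℝ} (h : HalfLineEstimate ι (A₀ + Q ∘L ι) Tr C) (hC : 0 < C)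
    (hε : 6 * C * ε ^ 2 ≤ 1) {A : ℝ → H₁ →L[ℝ] H₀} {β : ℝ → ℝ} (hβ : ContDiff ℝ ∞ β)
    (hβ1 : ∀ s, |β s| ≤ 1) {m : ℝ} (hm : ∀ s, |deriv β s| ≤ m) {T : ℝ}
    (hdT : ∀ s, T < s → deriv β s = 0)
    (hclose : ∀ s, 0 ≤ s → β s ≠ 0 → ‖A₀ - A s‖ ≤ ε) (hQ : ∀ s, T < s → β s = 0 ∨ Q = 0)
    (hTr : ∀ x M, Tr₀ x M → Tr (β 0 • x) M) {S : Set ℝ} (hSm : MeasurableSet S)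
    (hS : ∀ᵐ s : ℝ, s ∈ S → β s = 1 ∧ deriv β s = 0) :
    ∃ C' : ℝ, 0 ≤ C' ∧ ∀ {u : ℝ → H₁} {v f : ℝ → H₀}, IsTrajectory ι u v f →
      HasWeakDeriv (fun s => ι (u s)) v → MemLp (fun s => A s (u s)) 2 halfLine →
      ∀ M, 0 ≤ M → Tr₀ (f 0) M →
      ∫⁻ s in S, ENNReal.ofReal (‖u s‖ ^ 2 + ‖v s‖ ^ 2) ∂halfLine ≤
        ENNReal.ofReal (C' * ((∫ s in Icc 0 T, ‖ι (u s)‖ ^ 2) +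
          (∫ s in Ici (0 : ℝ), ‖v s + A s (u s)‖ ^ 2) + M)) := by
  -- The perturbed estimate gives `2C (3 · 2 (W + m² J) + 3 ‖Q‖² J + M)`, with `W`, `J` and `M` the
  -- three terms on the right of the claim.
  refine ⟨2 * C * (6 + 6 * m ^ 2 + 3 * ‖Q‖ ^ 2 + 1), by positivity,
    fun {u v f} ht hw hAu M hM0 hM => ?_⟩
  have hβ' : Continuous (deriv β) := hβ.continuous_deriv (by simp)
  have hm1 : ∀ s, |β s| ≤ max 1 m := fun s => (hβ1 s).trans (le_max_left _ _)
  have hm2 : ∀ s, |deriv β s| ≤ max 1 m := fun s => (hm s).trans (le_max_right _ _)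
  have hct := ht.cutoff hw hβ hm1 hm2
  have hAu' : MemLp (fun s => A s (β s • u s)) 2 halfLine := by
    simp only [map_smul]
    exact memLp_smul_of_bounded hβ.continuous hβ1 hAu
  have hest := h.perturb hC hε hct hAu' (by
    filter_upwards [ae_restrict_mem measurableSet_Ici] with s hs
    by_cases h0 : β s = 0
    · simp [h0]
    · exact (A₀ - A s).le_of_opNorm_le (hclose s hs h0) _) (hTr _ _ hM)
  have hιu : MemLp (fun s => ι (u s)) 2 halfLine := ι.comp_memLp' ht.memLp_path
  have hw2 : MemLp (fun s => v s + A s (u s)) 2 halfLine := ht.memLp_deriv.add hAu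
  have iW : Integrable (fun s => ‖v s + A s (u s)‖ ^ 2) halfLine :=
    hw2.integrable_norm_pow (by simp)
  have iJ : Integrable ((Icc 0 T).indicator fun s => ‖ι (u s)‖ ^ 2) halfLine :=
    (hιu.integrable_norm_pow (by simp) : Integrable (fun s => ‖ι (u s)‖ ^ 2) halfLine).indicator
      measurableSet_Icc
  have eJ : ∫ s in Ici (0 : ℝ), (Icc 0 T).indicator (fun s => ‖ι (u s)‖ ^ 2) s =
      ∫ s in Icc 0 T, ‖ι (u s)‖ ^ 2 := by
    rw [integral_indicator measurableSet_Icc, Measure.restrict_restrict measurableSet_Icc,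
      inter_eq_left.2 Icc_subset_Ici_self]
  set J := ∫ s in Icc 0 T, ‖ι (u s)‖ ^ 2
  set W := ∫ s in Ici (0 : ℝ), ‖v s + A s (u s)‖ ^ 2
  have hJ : 0 ≤ J := integral_nonneg fun s => by positivity
  have hW : 0 ≤ W := integral_nonneg fun s => by positivity
  have e1 : ∫ s in Ici (0 : ℝ), ‖β s • v s + deriv β s • ι (u s) + A s (β s • u s)‖ ^ 2 ≤
      2 * (W + m ^ 2 * J) := by
    rw [← eJ, ← integral_const_mul (m ^ 2), ← integral_add iW (iJ.const_mul _),
      ← integral_const_mul]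
    refine integral_mono_ae ((hct.memLp_deriv.add hAu').integrable_norm_pow (by simp))
      ((iW.add (iJ.const_mul _)).const_mul _) ?_
    filter_upwards [ae_restrict_mem measurableSet_Ici] with s hs
    -- Cutting off commutes with the operator except for `β' ι u`, an error of order zero that
    -- vanishes beyond `T`.
    have e : β s • v s + deriv β s • ι (u s) + A s (β s • u s) =
        β s • (v s + A s (u s)) + deriv β s • ι (u s) := by
      rw [map_smul, smul_add]
      abel
    rw [e]
    refine (norm_sq_add_two_le _ _).trans (mul_le_mul_of_nonneg_left (add_le_add ?_ ?_) two_pos.le)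
    · rw [norm_smul, mul_pow]
      refine mul_le_of_le_one_left (by positivity) ?_
      exact pow_le_one₀ (norm_nonneg _) (hβ1 s)
    · by_cases hsT : s ≤ T
      · rw [indicator_of_mem (show s ∈ Icc 0 T from ⟨hs, hsT⟩), norm_smul, mul_pow]
        gcongr
        exact hm s
      · rw [hdT s (not_le.1 hsT), zero_smul, norm_zero, zero_pow two_ne_zero]
        exact mul_nonneg (sq_nonneg _) (indicator_nonneg (fun _ _ => by positivity) _)
  have e2 : ∫ s in Ici (0 : ℝ), ‖Q (ι (β s • u s))‖ ^ 2 ≤ ‖Q‖ ^ 2 * J := by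
    rw [← eJ, ← integral_const_mul]
    refine integral_mono_ae (((Q ∘L ι).comp_memLp' hct.memLp_path).integrable_norm_pow (by simp))
      (iJ.const_mul _) ?_
    filter_upwards [ae_restrict_mem measurableSet_Ici] with s hs
    by_cases hsT : s ≤ T
    · rw [indicator_of_mem (show s ∈ Icc 0 T from ⟨hs, hsT⟩)]
      refine (sq_norm_apply_le Q _).trans ?_
      gcongr
      rw [map_smul, norm_smul]
      exact mul_le_of_le_one_left (norm_nonneg _) (hβ1 s)
    · have hz : Q (ι (β s • u s)) = 0 := by
        rcases hQ s (not_le.1 hsT) with h0 | h0 <;> simp [h0]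
      rw [hz, norm_zero, zero_pow two_ne_zero]
      exact mul_nonneg (sq_nonneg _) (indicator_nonneg (fun _ _ => by positivity) _)
  have iu : Integrable (fun s => ‖β s • u s‖ ^ 2) halfLine :=
    hct.memLp_path.integrable_norm_pow (by simp)
  have iv : Integrable (fun s => ‖β s • v s + deriv β s • ι (u s)‖ ^ 2) halfLine :=
    hct.memLp_deriv.integrable_norm_pow (by simp)
  have iuv : Integrable (fun s => ‖β s • u s‖ ^ 2 + ‖β s • v s + deriv β s • ι (u s)‖ ^ 2)
      halfLine := iu.add iv
  calc ∫⁻ s in S, ENNReal.ofReal (‖u s‖ ^ 2 + ‖v s‖ ^ 2) ∂halfLine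
      = ∫⁻ s in S, ENNReal.ofReal (‖β s • u s‖ ^ 2 +
          ‖β s • v s + deriv β s • ι (u s)‖ ^ 2) ∂halfLine := by
        refine lintegral_congr_ae ?_
        have h1 : ∀ᵐ s ∂halfLine, s ∈ S → β s = 1 ∧ deriv β s = 0 := ae_restrict_of_ae hS
        filter_upwards [ae_restrict_of_ae h1, ae_restrict_mem hSm] with s hs hsS
        rw [(hs hsS).1, (hs hsS).2, one_smul, one_smul, zero_smul, add_zero]
    _ ≤ ∫⁻ s in Ici (0 : ℝ), ENNReal.ofReal (‖β s • u s‖ ^ 2 +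
          ‖β s • v s + deriv β s • ι (u s)‖ ^ 2) := setLIntegral_le_lintegral _ _
    _ = ENNReal.ofReal ((∫ s in Ici (0 : ℝ), ‖β s • u s‖ ^ 2) +
          ∫ s in Ici (0 : ℝ), ‖β s • v s + deriv β s • ι (u s)‖ ^ 2) := by
        rw [← integral_add iu iv, ofReal_integral_eq_lintegral_ofReal iuv
          (Eventually.of_forall fun s => by positivity)]
    _ ≤ _ := by
        refine ENNReal.ofReal_le_ofReal (hest.trans ?_)
        rw [mul_assoc (2 * C)]
        refine mul_le_mul_of_nonneg_left ?_ (by positivity)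
        have hmJ : 0 ≤ m ^ 2 * J := by positivity
        have hmW : 0 ≤ m ^ 2 * W := by positivity
        have hmM : 0 ≤ m ^ 2 * M := by positivity
        have hQW : 0 ≤ ‖Q‖ ^ 2 * W := by positivity
        have hQM : 0 ≤ ‖Q‖ ^ 2 * M := by positivity
        nlinarith

theorem exists_pos_six_mul_sq_le {C : ℝ} (hC : 0 < C) : ∃ ε : ℝ, 0 < ε ∧ 6 * C * ε ^ 2 ≤ 1 := by
  refine ⟨1 / (6 * C + 1), by positivity, ?_⟩
  rw [one_div, inv_pow, ← div_eq_mul_inv, div_le_one (by positivity)]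
  nlinarith

theorem SpectralBasis.TraceBound.nonneg {ι A : H₁ →L[ℝ] H₀} {I : Type*}
    {D : SpectralBasis ι A I} {x : H₀} {M : ℝ} (h : D.TraceBound x M) : 0 ≤ M := by
  simpa using h ∅

theorem SpectralBasis.TraceBound.smul {ι A : H₁ →L[ℝ] H₀} {I : Type*}
    {D : SpectralBasis ι A I} {x : H₀} {M : ℝ} (h : D.TraceBound x M) {b : ℝ} (hb : |b| ≤ 1) :
    D.TraceBound (b • x) M := by
  intro F
  have e : ∑ i ∈ F, D.a i * D.coord i (b • x) ^ 2 = b ^ 2 * ∑ i ∈ F, D.a i * D.coord i x ^ 2 := by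
    rw [Finset.mul_sum]
    refine Finset.sum_congr rfl fun i _ => ?_
    rw [map_smul, smul_eq_mul]
    ring
  rw [e]
  refine (mul_le_mul_of_nonneg_left (h F) (sq_nonneg b)).trans ?_
  exact mul_le_of_le_one_left h.nonneg ((sq_le_one_iff_abs_le_one b).2 hb)

theorem SpectralBasis.traceBound_zero {ι A : H₁ →L[ℝ] H₀} {I : Type*}
    (D : SpectralBasis ι A I) {M : ℝ} (hM : 0 ≤ M) : D.TraceBound 0 M := by
  intro F
  simpa using hM

/-! ### Patching the local estimates over the half line -/

section Global

variable {ι : H₁ →L[ℝ] H₀} [HilbertPair ι] {A : ℝ → H₁ →L[ℝ] H₀} {I : Type*}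

/-- The property that the norm of a path over the set `S` satisfies the estimate. -/
def LocalBound (ι : H₁ →L[ℝ] H₀) (A : ℝ → H₁ →L[ℝ] H₀) (Tr : H₀ → ℝ → Prop) (T : ℝ)
    (S : Set ℝ) : Prop :=
  ∃ C : ℝ, 0 ≤ C ∧ ∀ {u : ℝ → H₁} {v f : ℝ → H₀}, IsTrajectory ι u v f →
    HasWeakDeriv (fun s => ι (u s)) v → MemLp (fun s => A s (u s)) 2 halfLine →
    ∀ M, 0 ≤ M → Tr (f 0) M →
    ∫⁻ s in S, ENNReal.ofReal (‖u s‖ ^ 2 + ‖v s‖ ^ 2) ∂halfLine ≤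
      ENNReal.ofReal (C * ((∫ s in Icc 0 T, ‖ι (u s)‖ ^ 2) +
        (∫ s in Ici (0 : ℝ), ‖v s + A s (u s)‖ ^ 2) + M))

theorem LocalBound.mono {Tr : H₀ → ℝ → Prop} {T : ℝ} {S S' : Set ℝ} (hS : S ⊆ S')
    (h : LocalBound ι A Tr T S') : LocalBound ι A Tr T S := by
  obtain ⟨C, hC, h⟩ := h
  exact ⟨C, hC, fun ht hw hAu M hM hTr => (lintegral_mono_set hS).trans (h ht hw hAu M hM hTr)⟩

theorem LocalBound.union {Tr : H₀ → ℝ → Prop} {T : ℝ} {S S' : Set ℝ}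
    (h : LocalBound ι A Tr T S) (h' : LocalBound ι A Tr T S') :
    LocalBound ι A Tr T (S ∪ S') := by
  obtain ⟨C, hC, h⟩ := h
  obtain ⟨C', hC', h'⟩ := h'
  refine ⟨C + C', by positivity, fun {u v f} ht hw hAu M hM hTr => ?_⟩
  -- The lower Lebesgue integral is subadditive over arbitrary sets, without measurability or
  -- integrability conditions.
  refine (lintegral_union_le _ _ _).trans
    ((add_le_add (h ht hw hAu M hM hTr) (h' ht hw hAu M hM hTr)).trans (le_of_eq ?_))
  have hJ : 0 ≤ ∫ s in Icc 0 T, ‖ι (u s)‖ ^ 2 := integral_nonneg fun s => by positivity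
  have hW : 0 ≤ ∫ s in Ici (0 : ℝ), ‖v s + A s (u s)‖ ^ 2 :=
    integral_nonneg fun s => by positivity
  rw [← ENNReal.ofReal_add (by positivity) (by positivity), add_mul]

theorem LocalBound.empty {Tr : H₀ → ℝ → Prop} {T : ℝ} : LocalBound ι A Tr T ∅ :=
  ⟨0, le_rfl, fun _ _ _ _ _ _ => by simp⟩

/-- At zero `A 0` is invertible, so no correction is needed and the trace is measured in its own
eigenbasis. Elsewhere the corrected operator has an unrelated eigenbasis, which is harmless because
the cutoff makes the trace zero. The predicate `Tr` treats both cases at once. -/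
theorem IsHessianPath.exists_estimate_at (hA : IsHessianPath ι A)
    (D₀ : SpectralBasis ι (A 0) I) {s₀ : ℝ} (hs₀ : 0 ≤ s₀) :
    ∃ (Q : H₀ →L[ℝ] H₀) (Tr : H₀ → ℝ → Prop) (C : ℝ), 0 < C ∧
      HalfLineEstimate ι (A s₀ + Q ∘L ι) Tr C ∧
      ∀ (b : ℝ) (x : H₀) (M : ℝ), |b| ≤ 1 → (s₀ ≠ 0 → b = 0) → D₀.TraceBound x M → Tr (b • x) M := by
  by_cases h0 : s₀ = 0
  · subst h0
    obtain ⟨C, hC, h⟩ := D₀.exists_halfLine_estimate hA.invertible_zero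
    refine ⟨0, D₀.TraceBound, C, hC, ?_, fun b x M hb _ hx => hx.smul hb⟩
    rw [ContinuousLinearMap.zero_comp, add_zero]
    exact fun ht M hM => h ht M hM
  · obtain ⟨Q, hQ1, hQ2⟩ := (hA.isHessian s₀ hs₀).exists_correction
    obtain ⟨J, ⟨D⟩⟩ := exists_spectralBasis hQ1 hQ2
    obtain ⟨C, hC, h⟩ := D.exists_halfLine_estimate hQ2
    refine ⟨Q, D.TraceBound, C, hC, fun ht M hM => h ht M hM, fun b x M _ hb hx => ?_⟩
    rw [hb h0, zero_smul]
    exact D.traceBound_zero hx.nonneg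

/-- Freezing the coefficients at `s₀`: on a small enough support of the cutoff, `A s` is within `ε`
of `A s₀`. -/
theorem IsHessianPath.localBound_nhds (hA : IsHessianPath ι A) (D₀ : SpectralBasis ι (A 0) I)
    {s₀ T : ℝ} (hs₀ : 0 ≤ s₀) (hT : s₀ + 1 ≤ T) :
    ∃ r : ℝ, 0 < r ∧ LocalBound ι A D₀.TraceBound T (Metric.ball s₀ r) := by
  obtain ⟨Q, Tr, C, hC, hest, htr⟩ := hA.exists_estimate_at D₀ hs₀
  obtain ⟨ε, hε, hεC⟩ := exists_pos_six_mul_sq_le hC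
  obtain ⟨δ, hδ, hcont⟩ := Metric.continuousWithinAt_iff.1 (hA.continuousOn s₀ hs₀) ε hε
  -- `ρ ≤ δ` gives closeness of the operators, `ρ ≤ 1` keeps the support below `T`, and `ρ ≤ s₀`
  -- makes the cutoff vanish at zero when `s₀ ≠ 0`.
  obtain ⟨ρ, hρ, hρδ, hρ1, hρs⟩ : ∃ ρ : ℝ, 0 < ρ ∧ ρ ≤ δ ∧ ρ ≤ 1 ∧ (s₀ ≠ 0 → ρ ≤ s₀) := by
    by_cases h0 : s₀ = 0
    · exact ⟨min δ 1, lt_min hδ one_pos, min_le_left _ _, min_le_right _ _, fun h => (h h0).elim⟩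
    · have hpos : 0 < s₀ := lt_of_le_of_ne hs₀ (Ne.symm h0)
      exact ⟨min (min δ 1) s₀, lt_min (lt_min hδ one_pos) hpos,
        (min_le_left _ _).trans (min_le_left _ _), (min_le_left _ _).trans (min_le_right _ _),
        fun _ => min_le_right _ _⟩
  let β : ContDiffBump s₀ := ⟨ρ / 2, ρ, by positivity, by linarith⟩
  have hsupp : ∀ s, β s ≠ 0 → |s - s₀| < ρ := by
    intro s hs
    have h1 : s ∈ Function.support β := hs
    rw [β.support_eq, Metric.mem_ball, Real.dist_eq] at h1
    exact h1
  have hd : Continuous (deriv β) := (β.contDiff (n := 1)).continuous_deriv (by simp)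
  obtain ⟨m, hm⟩ := hd.bounded_above_of_compact_support β.hasCompactSupport.deriv
  have hβ1 : ∀ s, |β s| ≤ 1 := fun s => by
    rw [abs_of_nonneg β.nonneg]
    exact β.le_one
  refine ⟨ρ / 2, by positivity, ?_⟩
  refine hest.exists_cutoff_bound hC hεC (β := β) β.contDiff hβ1 hm (fun s hs => ?_)
    (fun s hs hβs => ?_) (fun s hs => Or.inl ?_) (fun x M hx => htr _ x M (hβ1 0) (fun h0 => ?_) hx)
    Metric.isOpen_ball.measurableSet (Eventually.of_forall fun s hs => ⟨?_, ?_⟩)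
  · by_contra hne
    have h1 := support_deriv_subset (f := β) (Function.mem_support.2 hne)
    rw [β.tsupport_eq, Metric.mem_closedBall, Real.dist_eq] at h1
    have h2 := (le_abs_self (s - s₀)).trans h1
    change s - s₀ ≤ ρ at h2
    linarith
  · have h1 := hcont (x := s) hs (by rw [Real.dist_eq]; exact (hsupp s hβs).trans_le hρδ)
    rw [dist_eq_norm, norm_sub_rev] at h1
    exact h1.le
  · by_contra hne
    have h2 := (le_abs_self (s - s₀)).trans_lt (hsupp s hne)
    linarith
  · by_contra hne
    have h1 := hsupp 0 hne
    rw [zero_sub, abs_neg, abs_of_nonneg hs₀] at h1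
    exact absurd (hρs h0) (not_le.2 h1)
  · exact β.one_of_mem_closedBall (Metric.ball_subset_closedBall hs)
  · rw [(β.eventuallyEq_one_of_mem_ball hs).deriv_eq]
    exact deriv_const _ _

/-- Beyond `R` the path is within `ε` of its limit. The limit is invertible, so `Q = 0` and the only
error of order zero comes from the derivative of the cutoff, between `R` and `R + 1`. -/
theorem IsHessianPath.localBound_atTop (hA : IsHessianPath ι A) (D₀ : SpectralBasis ι (A 0) I) :
    ∃ R : ℝ, 0 ≤ R ∧ ∀ T, R + 1 ≤ T → LocalBound ι A D₀.TraceBound T (Ici (R + 1)) := by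
  obtain ⟨Ap, hlim, hHess, hinv⟩ := hA.exists_limit
  obtain ⟨J, ⟨D⟩⟩ := exists_spectralBasis hHess.symmetrizable hinv
  obtain ⟨C, hC, h⟩ := D.exists_halfLine_estimate hinv
  have hest : HalfLineEstimate ι (Ap + (0 : H₀ →L[ℝ] H₀) ∘L ι) D.TraceBound C := by
    rw [ContinuousLinearMap.zero_comp, add_zero]
    exact fun ht M hM => h ht M hM
  obtain ⟨ε, hε, hεC⟩ := exists_pos_six_mul_sq_le hC
  obtain ⟨R₀, hR₀⟩ := Metric.tendsto_atTop.1 hlim ε hε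
  set R := max R₀ 0
  refine ⟨R, le_max_right _ _, fun T hT => ?_⟩
  let β : ℝ → ℝ := fun s => Real.smoothTransition (s - R)
  have hβ : ContDiff ℝ ∞ β := Real.smoothTransition.contDiff.comp (contDiff_id.sub contDiff_const)
  have hβ0 : ∀ s, s ≤ R → β s = 0 := fun s hs =>
    Real.smoothTransition.zero_of_nonpos (by linarith)
  have hβone : ∀ s, R + 1 ≤ s → β s = 1 := fun s hs =>
    Real.smoothTransition.one_of_one_le (by linarith)
  have hβ1 : ∀ s, |β s| ≤ 1 := fun s => by
    rw [abs_of_nonneg (Real.smoothTransition.nonneg _)]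
    exact Real.smoothTransition.le_one _
  have hd : Continuous (deriv β) := hβ.continuous_deriv (by simp)
  have hd0 : ∀ s, s < R → deriv β s = 0 := fun s hs => by
    have h1 : β =ᶠ[𝓝 s] fun _ => 0 := by
      filter_upwards [Iio_mem_nhds hs] with t ht
      exact hβ0 t (le_of_lt ht)
    rw [h1.deriv_eq, deriv_const]
  have hd1 : ∀ s, R + 1 < s → deriv β s = 0 := fun s hs => by
    have h1 : β =ᶠ[𝓝 s] fun _ => 1 := by
      filter_upwards [Ioi_mem_nhds hs] with t ht
      exact hβone t (le_of_lt ht)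
    rw [h1.deriv_eq, deriv_const]
  obtain ⟨m, hm⟩ := isCompact_Icc.exists_bound_of_continuousOn
    (hd.continuousOn : ContinuousOn (deriv β) (Icc R (R + 1)))
  have hm' : ∀ s, |deriv β s| ≤ |m| := by
    intro s
    by_cases hs : s ∈ Icc R (R + 1)
    · exact (hm s hs).trans (le_abs_self m)
    · have h0 : deriv β s = 0 := by
        by_cases h1 : s < R
        · exact hd0 s h1
        · exact hd1 s (not_le.1 fun h2 => hs ⟨not_lt.1 h1, h2⟩)
      rw [h0, abs_zero]
      exact abs_nonneg _
  refine hest.exists_cutoff_bound hC hεC hβ hβ1 hm' (fun s hs => hd1 s (hT.trans_lt hs))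
    (fun s hs hβs => ?_) (fun s hs => Or.inr rfl) (fun x M hx => ?_) measurableSet_Ici ?_
  · have hRs : R ≤ s := by
      by_contra hlt
      exact hβs (hβ0 s (not_le.1 hlt).le)
    have h1 := hR₀ s ((le_max_left _ _).trans hRs)
    rw [dist_eq_norm, norm_sub_rev] at h1
    exact h1.le
  · rw [hβ0 0 (le_max_right _ _), zero_smul]
    exact D.traceBound_zero hx.nonneg
  · have hne : ∀ᵐ s : ℝ, s ≠ R + 1 := by simp [ae_iff, measure_singleton]
    filter_upwards [hne] with s hs hsR
    exact ⟨hβone s hsR, hd1 s (lt_of_le_of_ne hsR (Ne.symm hs))⟩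

/-- The estimate for paths, with the trace at zero bounded in terms of a spectral basis. -/
theorem IsHessianPath.exists_global_bound (hA : IsHessianPath ι A)
    (D₀ : SpectralBasis ι (A 0) I) :
    ∃ T : ℝ, 0 < T ∧ LocalBound ι A D₀.TraceBound T (Ici 0) := by
  obtain ⟨R, hR, htop⟩ := hA.localBound_atTop D₀
  -- Local estimates at points of `[0, R + 1]` use cutoffs that reach one unit further.
  refine ⟨R + 2, by linarith, ?_⟩
  have h1 : LocalBound ι A D₀.TraceBound (R + 2) (Icc 0 (R + 1)) := by
    refine isCompact_Icc.induction_on (p := LocalBound ι A D₀.TraceBound (R + 2)) LocalBound.empty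
      (fun s t hst h => h.mono hst) (fun s t hs ht => hs.union ht) fun s₀ hs₀ => ?_
    obtain ⟨r, hr, hb⟩ := hA.localBound_nhds D₀ (T := R + 2) hs₀.1 (by linarith [hs₀.2])
    exact ⟨_, mem_nhdsWithin_of_mem_nhds (Metric.ball_mem_nhds s₀ hr), hb⟩
  refine (h1.union (htop (R + 2) (by linarith))).mono fun s hs => ?_
  rcases le_total s (R + 1) with h | h
  · exact Or.inl ⟨hs, h⟩
  · exact Or.inr h

end Global

theorem norm_sq_eq_integral {E : Type*} [NormedAddCommGroup E] [InnerProductSpace ℝ E]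
    (g : Lp E 2 halfLine) : ‖g‖ ^ 2 = ∫ s in Ici (0 : ℝ), ‖g s‖ ^ 2 := by
  rw [← real_inner_self_eq_norm_sq, L2.inner_def]
  simp only [real_inner_self_eq_norm_sq]

end HessianPath

end

theorem mainTheorem6 {H₀ H₁ : Type*}
    [NormedAddCommGroup H₀] [InnerProductSpace ℝ H₀] [CompleteSpace H₀]
    [NormedAddCommGroup H₁] [InnerProductSpace ℝ H₁] [CompleteSpace H₁]
    (ι : H₁ →L[ℝ] H₀) [HessianPath.HilbertPair ι]
    (A : ℝ → H₁ →L[ℝ] H₀) (hA : HessianPath.IsHessianPath ι A) :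
    ∃ hπ : IsCompl (HessianPath.HPlus ι (A 0)) (HessianPath.HMinus ι (A 0)),
      ∃ T c : ℝ, 0 < T ∧ 0 < c ∧
        ∀ ξ : HessianPath.P1 ι,
          ∃ ξ₀ : HessianPath.HHalf ι,
            HessianPath.IsValueAtZero ξ (HessianPath.HHalf.incl ι ξ₀) ∧
            ‖ξ‖ ≤ c * (HessianPath.normP0On ι T ξ + ‖HessianPath.DOp hA ξ‖ +
              ‖HessianPath.projPlus ι (A 0) hπ ξ₀‖) := by
  obtain ⟨I, ⟨D⟩⟩ := HessianPath.exists_spectralBasis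
    (hA.isHessian 0 le_rfl).symmetrizable hA.invertible_zero
  refine ⟨D.isCompl, ?_⟩
  obtain ⟨T, hT, C, hC, hbound⟩ := hA.exists_global_bound D
  obtain ⟨C₁, hC₁, hproj⟩ := D.exists_sum_le_projPlus D.isCompl
  -- The square root comes from `C (n² + d² + C₁ p²) ≤ C (1 + C₁) (n + d + p)²`; the summand `1`
  -- ensures positivity, since `C` may be zero.
  refine ⟨T, √(C * (1 + C₁)) + 1, hT, by positivity, fun ξ => ?_⟩
  have hu : MemLp (HessianPath.path ξ) 2 HessianPath.halfLine := Lp.memLp _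
  have hv : MemLp (HessianPath.weakDeriv ξ) 2 HessianPath.halfLine := Lp.memLp _
  have hw : HessianPath.HasWeakDeriv (fun s => ι (HessianPath.path ξ s))
      (HessianPath.weakDeriv ξ) := ξ.2
  have hAu := hA.memLp (HessianPath.path ξ)
  obtain ⟨f, hf⟩ := hw.exists_isTrajectory hu hv
  have hmem : f 0 ∈ HessianPath.halfSubmodule ι := D.mem_halfSubmodule.2
    (ne_top_of_le_ne_top ENNReal.ofReal_ne_top (D.energy_le_of_sum_le (D.sum_trace_le hf)))
  let ξ₀ : HessianPath.HHalf ι := ⟨f 0, hmem⟩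
  refine ⟨ξ₀, ⟨f, hf.continuousOn, hf.ae_eq, rfl⟩, ?_⟩
  set p := ‖HessianPath.projPlus ι (A 0) D.isCompl ξ₀‖
  set n := HessianPath.normP0On ι T ξ
  set d := ‖HessianPath.DOp hA ξ‖
  have hn0 : 0 ≤ n := Real.sqrt_nonneg _
  have hd0 : 0 ≤ d := norm_nonneg _
  have hp0 : 0 ≤ p := norm_nonneg _
  -- The projection enters here: the signed boundary sum in the eigenbasis of `A 0` is at most `C₁
  -- p²`.
  have hb := hbound hf hw hAu (C₁ * p ^ 2) (by positivity) (hproj ξ₀)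
  have hn : ∫ s in Icc 0 T, ‖ι (HessianPath.path ξ s)‖ ^ 2 = n ^ 2 :=
    (Real.sq_sqrt (integral_nonneg fun s => by positivity)).symm
  have hd : ∫ s in Ici (0 : ℝ), ‖HessianPath.weakDeriv ξ s + A s (HessianPath.path ξ s)‖ ^ 2 =
      d ^ 2 := by
    rw [HessianPath.norm_sq_eq_integral]
    refine integral_congr_ae ?_
    filter_upwards [Lp.coeFn_add (HessianPath.weakDeriv ξ) hAu.toLp, hAu.coeFn_toLp] with s h1 h2
    have h3 : HessianPath.DOp hA ξ s = HessianPath.weakDeriv ξ s + A s (HessianPath.path ξ s) := by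
      rw [← h2]
      exact h1
    rw [h3]
  have iu : Integrable (fun s => ‖HessianPath.path ξ s‖ ^ 2) HessianPath.halfLine :=
    hu.integrable_norm_pow (by simp)
  have iv : Integrable (fun s => ‖HessianPath.weakDeriv ξ s‖ ^ 2) HessianPath.halfLine :=
    hv.integrable_norm_pow (by simp)
  have iuv : Integrable (fun s => ‖HessianPath.path ξ s‖ ^ 2 + ‖HessianPath.weakDeriv ξ s‖ ^ 2)
      HessianPath.halfLine := iu.add iv
  rw [hn, hd, Measure.restrict_restrict measurableSet_Ici, inter_self,
    ← ofReal_integral_eq_lintegral_ofReal iuv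
      (Eventually.of_forall fun s => by positivity),
    ENNReal.ofReal_le_ofReal_iff (by positivity), integral_add iu iv,
    ← HessianPath.norm_sq_eq_integral, ← HessianPath.norm_sq_eq_integral,
    ← HessianPath.P1.norm_sq] at hb
  have h1 : ‖ξ‖ ^ 2 ≤ (C * (1 + C₁)) * (n + d + p) ^ 2 := by
    refine hb.trans ?_
    rw [mul_assoc]
    refine mul_le_mul_of_nonneg_left ?_ hC
    have h2 : n ^ 2 + d ^ 2 + p ^ 2 ≤ (n + d + p) ^ 2 := by
      nlinarith [mul_nonneg hn0 hd0, mul_nonneg hn0 hp0, mul_nonneg hd0 hp0]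
    have h3 := mul_le_mul_of_nonneg_left h2 hC₁.le
    nlinarith [mul_nonneg hC₁.le (sq_nonneg n), mul_nonneg hC₁.le (sq_nonneg d), sq_nonneg p]
  have h2 : ‖ξ‖ ≤ √(C * (1 + C₁)) * (n + d + p) := by
    rw [← Real.sqrt_sq (by positivity : 0 ≤ n + d + p), ← Real.sqrt_mul (by positivity)]
    exact Real.le_sqrt_of_sq_le h1
  refine h2.trans (mul_le_mul_of_nonneg_right ?_ (by positivity))
  linarith
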